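/- Let $M$ be a smooth finite-dimensional (Hausdorff) manifold without boundary and let $H,K\subseteq TM$ be smooth vector subbundles with $T_pM=H_p\oplus K_p$ for all $p\in M$. Write $P^K_H\colon TM\to H$ for the projection along $K$, $P=P^H_K\colon TM\to K$ for the projection along $H$, and $Q^H_K\colon TM/H\to K$ for the canonical isomorphism. Let $C^H_p(u\wedge v)=[X,Y]_p+H_p\in T_pM/H_p$ for $u,v\in H_p$ be the curvature tensor of $H$, where $X,Y$ are any smooth sections of $H$ with $X_p=u$, $Y_p=v$. For a smooth path $\gamma\colon I\to M$ on a compact interval with $\dot\gamma(t)\in H_{\gamma(t)}$ for all $t$, let $\nabla^{\gamma^*K}$ be the canonical linear connection on $\gamma^*K$, given for a smooth section $Z$ of $\gamma^*K$ by $$\nabla^{\gamma^*K}_{\partial/\partial t}Z(t)=\Psi_{Z(t)}^{-1}\bigl(\omega_M\circ TP\circ\omega_M\bigr)\Bigl(\frac{dZ}{dt}(t)\Bigr)\in K_{\gamma(t)},$$ where $Z$ is regarded as a curve in $TM$, $P$ as a map $TM\to TM$, $\omega_M$ is the canonical involution of $T(TM)$, and $\Psi_{z}\colon T_xM\to T_z(T_xM)$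 is the canonical identification for $z\in T_xM$ (in local coordinates the right-hand side is $P'(\gamma)[Z]\dot\gamma+P(\gamma)\dot Z$). Let $(\gamma^*K)_s^t\colon K_{\gamma(s)}\to K_{\gamma(t)}$, $s,t\in I$, be its parallel transport. Let $I=[a,b]$ with $a<b$ be a compact interval, $s_0\in\mathbb R$, $\varepsilon>0$, and let $\beta\colon(s_0-\varepsilon,s_0+\varepsilon)\times I\to M$ be a smooth map such that $\frac{\partial\beta}{\partial t}(s,t)\in H_{\beta(s,t)}$ for all $s\in(s_0-\varepsilon,s_0+\varepsilon)$ and $t\in I$. Put $\beta_0=\beta(s_0,\cdot)$. Then $t\mapsto P^H_K\frac{\partial\beta}{\partial s}(s_0,t)$ is a smooth section of $\beta_0^*K$ and, for all $t\in I$, $$\nabla^{\beta_0^*K}_{\partial/\partial t}\,P^H_K\frac{\partial\beta}{\partial s}(s_0,t)=Q^H_K\,C^H_{\beta_0(t)}\Bigl(P^K_H\frac{\partial\beta}{\partial s}(s_0,t)\wedge\frac{\partial\beta}{\partial t}(s_0,t)\Bigr),$$ or, equivalently, for all $t_0,t\in I$, $$\frac{\partial}{\partial t}\Bigl\{(\beta_0^*K)^{t_0}_t\,P^H_K\frac{\partial\beta}{\partial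 s}(s_0,t)\Bigr\}=(\beta_0^*K)^{t_0}_t\,Q^H_K\,C^H_{\beta_0(t)}\Bigl(P^K_H\frac{\partial\beta}{\partial s}(s_0,t)\wedge\frac{\partial\beta}{\partial t}(s_0,t)\Bigr).$$ (Derivatives in $t$ at the end points of $I$ are one-sided.) -/

import Mathlib

open Set
open scoped Manifold ContDiff Bundle

noncomputable section

section TangentPaths

/-! ### Subbundles of the tangent bundle

`M` is a finite dimensional smooth manifold without boundary modelled on `E`. A family of
subspaces of the tangent spaces is `H : ∀ p : M, Submodule ℝ (TangentSpace 𝓘(ℝ, E) p)`. -/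

variable {E : Type*} [NormedAddCommGroup E] [NormedSpace ℝ E]
  {M : Type*} [TopologicalSpace M] [ChartedSpace E M] [IsManifold 𝓘(ℝ, E) ∞ M]

/-- `H` is a smooth vector subbundle of `TM`: around every point there is a smooth local frame
of `H`. -/
def IsSmoothSubbundle (H : ∀ p : M, Submodule ℝ (TangentSpace 𝓘(ℝ, E) p)) : Prop :=
  ∀ p : M, ∃ U : Set M, IsOpen U ∧ p ∈ U ∧
    ∃ (r : ℕ) (X : Fin r → ∀ q : M, TangentSpace 𝓘(ℝ, E) q),
      (∀ i, ContMDiffOn 𝓘(ℝ, E) 𝓘(ℝ, E).tangent ∞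
        (fun q => (⟨q, X i q⟩ : TangentBundle 𝓘(ℝ, E) M)) U) ∧
      ∀ q ∈ U, LinearIndependent ℝ (fun i => X i q) ∧
        Submodule.span ℝ (Set.range fun i => X i q) = H q

/-- `X` is a smooth section of `H`, that is, a smooth vector field on `M` with values in `H`. -/
def IsSmoothSection (H : ∀ p : M, Submodule ℝ (TangentSpace 𝓘(ℝ, E) p))
    (X : ∀ p : M, TangentSpace 𝓘(ℝ, E) p) : Prop :=
  ContMDiff 𝓘(ℝ, E) 𝓘(ℝ, E).tangent ∞ (fun q => (⟨q, X q⟩ : TangentBundle 𝓘(ℝ, E) M)) ∧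
    ∀ q, X q ∈ H q

open Classical in
/-- The curvature tensor `C^H_p (u ∧ v) ∈ T_pM / H_p`, for `u, v ∈ H_p`: the class modulo `H_p` of
the Lie bracket `[X, Y]_p`, where `X`, `Y` are smooth sections of `H` with `X_p = u`, `Y_p = v`.
For a smooth subbundle such sections exist and the class does not depend on them; the value `0` in
the other case is a mere convention. -/
def curvature (H : ∀ p : M, Submodule ℝ (TangentSpace 𝓘(ℝ, E) p)) (p : M) (u v : H p) :
    TangentSpace 𝓘(ℝ, E) p ⧸ H p :=
  if h : ∃ XY : (∀ q : M, TangentSpace 𝓘(ℝ, E) q) × (∀ q : M, TangentSpace 𝓘(ℝ, E) q),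
      IsSmoothSection H XY.1 ∧ IsSmoothSection H XY.2 ∧ XY.1 p = u ∧ XY.2 p = v then
    (H p).mkQ (VectorField.mlieBracket 𝓘(ℝ, E) h.choose.1 h.choose.2 p)
  else 0

/-! ### Projections of two supplementary subbundles -/

/-- For supplementary families `A`, `B`, the projection `T_pM → A_p` along `B_p`. -/
def projAlong {A B : ∀ p : M, Submodule ℝ (TangentSpace 𝓘(ℝ, E) p)}
    (h : ∀ p, IsCompl (A p) (B p)) (p : M) : TangentSpace 𝓘(ℝ, E) p →ₗ[ℝ] A p :=
  (A p).projectionOnto (B p) (h p)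

/-- For supplementary families `A`, `B`, the canonical isomorphism `T_pM / A_p ≃ B_p`. -/
def quotIso {A B : ∀ p : M, Submodule ℝ (TangentSpace 𝓘(ℝ, E) p)}
    (h : ∀ p, IsCompl (A p) (B p)) (p : M) : (TangentSpace 𝓘(ℝ, E) p ⧸ A p) ≃ₗ[ℝ] B p :=
  (A p).quotientEquivOfIsCompl (B p) (h p)

/-- The projection on `K` along `H` as a fibre preserving map `P : TM → TM`. -/
def projMap {H K : ∀ p : M, Submodule ℝ (TangentSpace 𝓘(ℝ, E) p)}
    (h : ∀ p, IsCompl (H p) (K p)) (X : TangentBundle 𝓘(ℝ, E) M) : TangentBundle 𝓘(ℝ, E) M :=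
  ⟨X.1, (projAlong (fun p => (h p).symm) X.1 X.2 : K X.1)⟩

/-! ### The canonical involution and the connection along a path tangent to `H` -/

/-- The canonical involution `ω_M` of `T(TM)`. In Mathlib a tangent vector of `TM` at `(x, y)` is
the pair `(u, w) : E × E` of its components in the chart `Tχ` of `TM` induced by the preferred chart
`χ` of `M` at `x`, and the preferred chart of `TM` at `(x, u)` is the same `Tχ`. Hence
`(x, y; u, w) ↦ (x, u; y, w)` is the standard local expression of the involution. -/
def canonicalFlip (W : TangentBundle 𝓘(ℝ, E).tangent (TangentBundle 𝓘(ℝ, E) M)) :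
    TangentBundle 𝓘(ℝ, E).tangent (TangentBundle 𝓘(ℝ, E) M) :=
  ⟨⟨W.1.1, (W.2 : E × E).1⟩, ((W.1.2 : E), (W.2 : E × E).2)⟩

/-- The projection `ω_M ∘ TP ∘ ω_M` of `T(TM)`, for `P` the projection on `K` along `H`. At `k ∈ K`,
on the vectors that are tangent to `K` and lie over `H`, it is the vertical projection of the
canonical linear connection of `K` along the paths tangent to `H`: its kernel there is the
horizontal space `T_k K ∩ ω_M (T H)`. -/
def verticalProj {H K : ∀ p : M, Submodule ℝ (TangentSpace 𝓘(ℝ, E) p)}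
    (h : ∀ p, IsCompl (H p) (K p))
    (W : TangentBundle 𝓘(ℝ, E).tangent (TangentBundle 𝓘(ℝ, E) M)) :
    TangentBundle 𝓘(ℝ, E).tangent (TangentBundle 𝓘(ℝ, E) M) :=
  canonicalFlip (tangentMap 𝓘(ℝ, E).tangent 𝓘(ℝ, E).tangent (projMap h) (canonicalFlip W))

/-- The velocity `γ'(t)` of a path `γ : [a, b] → M` (one-sided at the end points). -/
def pathVelocity (γ : ℝ → M) (a b t : ℝ) : TangentSpace 𝓘(ℝ, E) (γ t) :=
  mfderivWithin 𝓘(ℝ, ℝ) 𝓘(ℝ, E) γ (Icc a b) t (1 : ℝ)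

/-- The velocity in `T(TM)` of the vector field `t ↦ Z t ∈ T_{γ t}M` along `γ : [a, b] → M`, seen as
a path in `TM`. -/
def liftVelocity (γ : ℝ → M) (a b : ℝ) (Z : ∀ t : ℝ, TangentSpace 𝓘(ℝ, E) (γ t)) (t : ℝ) :
    TangentBundle 𝓘(ℝ, E).tangent (TangentBundle 𝓘(ℝ, E) M) :=
  ⟨⟨γ t, Z t⟩, mfderivWithin 𝓘(ℝ, ℝ) 𝓘(ℝ, E).tangent
    (fun τ => (⟨γ τ, Z τ⟩ : TangentBundle 𝓘(ℝ, E) M)) (Icc a b) t (1 : ℝ)⟩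

/-- `Z` is a smooth section of `γ^* K` over `[a, b]`. -/
def IsSmoothAlong {K : ∀ p : M, Submodule ℝ (TangentSpace 𝓘(ℝ, E) p)} (γ : ℝ → M) (a b : ℝ)
    (Z : ∀ t : ℝ, K (γ t)) : Prop :=
  ContMDiffOn 𝓘(ℝ, ℝ) 𝓘(ℝ, E).tangent ∞
    (fun t => (⟨γ t, (Z t : TangentSpace 𝓘(ℝ, E) (γ t))⟩ : TangentBundle 𝓘(ℝ, E) M)) (Icc a b)

/-- The covariant derivative `∇_{∂/∂t} Z` on `γ^* K`, for `γ : [a, b] → M` tangent to `H`: the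
vertical projection of the velocity of `Z` is the vertical vector `(x, y; 0, w)`, which is
identified with the vector `w` of the fibre. -/
def covDeriv {H K : ∀ p : M, Submodule ℝ (TangentSpace 𝓘(ℝ, E) p)}
    (h : ∀ p, IsCompl (H p) (K p)) (γ : ℝ → M) (a b : ℝ) (Z : ∀ t : ℝ, K (γ t)) (t : ℝ) :
    TangentSpace 𝓘(ℝ, E) (γ t) :=
  ((verticalProj h (liftVelocity γ a b (fun τ => (Z τ : TangentSpace 𝓘(ℝ, E) (γ τ))) t)).2 :
    E × E).2

/-- `Z` is a parallel section of `γ^* K` over `[a, b]`. -/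
def IsParallelAlong {H K : ∀ p : M, Submodule ℝ (TangentSpace 𝓘(ℝ, E) p)}
    (h : ∀ p, IsCompl (H p) (K p)) (γ : ℝ → M) (a b : ℝ) (Z : ∀ t : ℝ, K (γ t)) : Prop :=
  IsSmoothAlong γ a b Z ∧ ∀ t ∈ Icc a b, covDeriv h γ a b Z t = 0

open Classical in
/-- The parallel transport operator `(γ^* K)_s^t : K_{γ s} → K_{γ t}`, for `γ : [a, b] → M` tangent
to `H` and `s, t ∈ [a, b]`: the linear map that sends `Z s` to `Z t` for the parallel sections `Z`.
It exists and is unique in this case; the value `0` otherwise is a mere convention. -/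
def parallelTransport {H K : ∀ p : M, Submodule ℝ (TangentSpace 𝓘(ℝ, E) p)}
    (h : ∀ p, IsCompl (H p) (K p)) (γ : ℝ → M) (a b s t : ℝ) : K (γ s) →ₗ[ℝ] K (γ t) :=
  if hL : ∃ L : K (γ s) →ₗ[ℝ] K (γ t), ∀ v : K (γ s),
      ∃ Z : ∀ τ : ℝ, K (γ τ), IsParallelAlong h γ a b Z ∧ Z s = v ∧ Z t = L v then
    hL.choose
  else 0

/-- For a family of paths `β(s, ·)`, the `K`-component of `∂β/∂s (s₀, t)`, as a section of
`β(s₀, ·)^* K`. -/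
def variationComponent {H K : ∀ p : M, Submodule ℝ (TangentSpace 𝓘(ℝ, E) p)}
    (h : ∀ p, IsCompl (H p) (K p)) (β : ℝ → ℝ → M) (s₀ t : ℝ) : K (β s₀ t) :=
  projAlong (fun p => (h p).symm) (β s₀ t)
    (mfderiv 𝓘(ℝ, ℝ) 𝓘(ℝ, E) (fun s => β s t) s₀ (1 : ℝ))

/-- The vector `Q C^H (P_H ∂β/∂s ∧ ξ) ∈ K` at the point `β(s₀, t)`, for `ξ ∈ H`; here `P_H` is the
projection on `H` along `K` and `Q : TM / H ≃ K`. -/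
def curvatureTerm {H K : ∀ p : M, Submodule ℝ (TangentSpace 𝓘(ℝ, E) p)}
    (h : ∀ p, IsCompl (H p) (K p)) (β : ℝ → ℝ → M) (s₀ t : ℝ) (ξ : H (β s₀ t)) : K (β s₀ t) :=
  quotIso h (β s₀ t) (curvature H (β s₀ t)
    (projAlong h (β s₀ t) (mfderiv 𝓘(ℝ, ℝ) 𝓘(ℝ, E) (fun s => β s t) s₀ (1 : ℝ))) ξ)

end TangentPaths

end

/-! Everything is read in a chart, where the projection on `K` along `H` becomes a field `p` of
idempotents. Write `u = ∂β/∂s`, `v = ∂β/∂t`, `m` for the mixed second derivative, and `D` for the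
derivative of `p`. Three relations hold: `D[w] p + p D[w] = D[w]`, from `p p = p`; `D[u] v + p m =
0`, from differentiating `p v = 0` in `s`; and `D[w] X + p X'[w] = 0` for every section `X` of `H`.

The covariant derivative of `p u` is `D[p u] v + p (D[v] u + p m)`. The second relation turns it
into `p D[v] u - D[u - p u] v`, and the first into `D[v](u - p u) - D[u - p u] v`. If `X`, `Y` are
sections of `H` extending `u - p u` and `v`, the third relation makes this `p (Y'[X] - X'[Y]) = p
[X, Y]`, the curvature term. This algebra is `covDeriv_eq_bracket_of_leibniz`; it enters the
manifold in `covDeriv_variationComponent`, through the smoothness of `p` (`contDiffOn_coordProj`)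
and the local formula `tcoord_covDeriv` for the connection.

For the formula with parallel transport, the equation of parallel sections is a linear differential
equation in each chart. Local solutions are glued along the compact interval
(`exists_isParallelAlong`), and uniqueness makes transport well defined, linear and transitive. The
derivative of the transported section is then the transport of the covariant derivative
(`hasDerivWithinAt_parallelTransport`), which converts the first formula into the second. -/

/-! ### Linear differential equations on compact intervals. -/

section LinearODE

open Filter Topology
open scoped NNReal

variable {F : Type*} [NormedAddCommGroup F] [NormedSpace ℝ F]

theorem exists_nnnorm_bound_of_continuousOn_Icc {A : ℝ → F →L[ℝ] F} {c d : ℝ}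
    (hA : ContinuousOn A (Icc c d)) : ∃ C : ℝ≥0, ∀ t ∈ Icc c d, ‖A t‖₊ ≤ C := by
  obtain ⟨C, hC⟩ := isCompact_Icc.exists_bound_of_continuousOn hA
  refine ⟨⟨max C 0, le_max_right _ _⟩, fun t ht => ?_⟩
  exact (hC t ht).trans (le_max_left _ _)

/-- A solution of a homogeneous linear differential equation on a compact interval that vanishes at
one point vanishes. -/
theorem linearODE_eq_zero {A : ℝ → F →L[ℝ] F} {c d : ℝ} (hA : ContinuousOn A (Icc c d))
    {z : ℝ → F} (hz : ∀ t ∈ Icc c d, HasDerivWithinAt z (A t (z t)) (Icc c d) t)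
    {s : ℝ} (hs : s ∈ Icc c d) (hzs : z s = 0) : ∀ t ∈ Icc c d, z t = 0 := by
  obtain ⟨C, hC⟩ := exists_nnnorm_bound_of_continuousOn_Icc hA
  have hlip : ∀ t ∈ Icc c d, LipschitzOnWith C (fun x => A t x) univ := fun t ht =>
    ((A t).lipschitz.weaken (hC t ht)).lipschitzOnWith
  have hcont : ContinuousOn z (Icc c d) := fun t ht => (hz t ht).continuousWithinAt
  have h0 : ∀ (t : ℝ) (S : Set ℝ), HasDerivWithinAt (fun _ : ℝ => (0 : F)) (A t 0) S t := by
    intro t S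
    simpa using hasDerivWithinAt_const t S (0 : F)
  intro t ht
  -- Gronwall uniqueness against the zero solution, forwards and backwards from `s`.
  rcases le_total s t with hst | hts
  · have hsub : Icc s d ⊆ Icc c d := Icc_subset_Icc_left hs.1
    refine ODE_solution_unique_of_mem_Icc_right (v := fun t x => A t x) (s := fun _ => univ)
      (K := C) (f := z) (g := fun _ => 0) (fun τ hτ => hlip τ (hsub ⟨hτ.1, hτ.2.le⟩))
      (hcont.mono hsub) (fun τ hτ => ?_) (fun _ _ => trivial) continuousOn_const
      (fun τ _ => h0 τ _) (fun _ _ => trivial) hzs ⟨hst, ht.2⟩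
    refine (hz τ (hsub ⟨hτ.1, hτ.2.le⟩)).mono_of_mem_nhdsWithin ?_
    exact mem_of_superset (Icc_mem_nhdsGE hτ.2) (Icc_subset_Icc_left (hs.1.trans hτ.1))
  · have hsub : Icc c s ⊆ Icc c d := Icc_subset_Icc_right hs.2
    refine ODE_solution_unique_of_mem_Icc_left (v := fun t x => A t x) (s := fun _ => univ)
      (K := C) (f := z) (g := fun _ => 0) (fun τ hτ => hlip τ (hsub ⟨hτ.1.le, hτ.2⟩))
      (hcont.mono hsub) (fun τ hτ => ?_) (fun _ _ => trivial) continuousOn_const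
      (fun τ _ => h0 τ _) (fun _ _ => trivial) hzs ⟨ht.1, hts⟩
    refine (hz τ (hsub ⟨hτ.1.le, hτ.2⟩)).mono_of_mem_nhdsWithin ?_
    exact mem_of_superset (Icc_mem_nhdsLE hτ.1) (Icc_subset_Icc_right (hτ.2.trans hs.2))

/-- Solutions of a homogeneous linear differential equation exist on intervals of a uniform
length. -/
theorem exists_linearODE_solution [CompleteSpace F] {A : ℝ → F →L[ℝ] F} {c d : ℝ}
    (hA : ContinuousOn A (Icc c d)) : ∃ δ > 0, ∀ c' d' : ℝ, Icc c' d' ⊆ Icc c d → d' - c' ≤ δ →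
      ∀ s ∈ Icc c' d', ∀ v : F, ∃ z : ℝ → F, z s = v ∧
        ∀ t ∈ Icc c' d', HasDerivWithinAt z (A t (z t)) (Icc c' d') t := by
  obtain ⟨C, hC⟩ := exists_nnnorm_bound_of_continuousOn_Icc hA
  -- Picard–Lindelöf is applied on the ball of radius `2‖v‖` about `0`, not about `v`: there the
  -- field is bounded by `2C‖v‖`, and a solution starting at `v` may move by `‖v‖`. The time allowed
  -- is thus independent of `v`. The summand `1` covers `C = 0`.
  refine ⟨1 / (2 * (C + 1)), by positivity, fun c' d' hsub hlen s hs v => ?_⟩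
  have hpl : IsPicardLindelof (fun t x => A t x) (⟨s, hs⟩ : Icc c' d') (0 : F) (2 * ‖v‖₊) ‖v‖₊
      (C * (2 * ‖v‖₊)) C := by
    refine ⟨fun t ht => ((A t).lipschitz.weaken (hC t (hsub ht))).lipschitzOnWith,
      fun x _ => (hA.mono hsub).clm_apply continuousOn_const, fun t ht x hx => ?_, ?_⟩
    · have h1 : ‖x‖ ≤ 2 * ‖v‖ := by simpa using hx
      have h2 : ‖A t‖ ≤ C := hC t (hsub ht)
      calc ‖A t x‖ ≤ ‖A t‖ * ‖x‖ := (A t).le_opNorm x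
        _ ≤ C * (2 * ‖v‖) := by gcongr
    · have hmax : max (d' - s) (s - c') ≤ 1 / (2 * ((C : ℝ) + 1)) := by
        refine max_le ?_ ?_ <;> linarith [hs.1, hs.2]
      have hCpos : (0 : ℝ) ≤ C := C.2
      push_cast
      calc (C : ℝ) * (2 * ‖v‖) * max (d' - s) (s - c')
          ≤ (C : ℝ) * (2 * ‖v‖) * (1 / (2 * (C + 1))) := by gcongr
        _ = (C / (C + 1)) * ‖v‖ := by field_simp
        _ ≤ 1 * ‖v‖ := by
          gcongr
          rw [div_le_one (by positivity)]
          linarith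
        _ = 2 * ‖v‖ - ‖v‖ := by ring
  exact hpl.exists_eq_forall_mem_Icc_hasDerivWithinAt (by simp)

/-- Solutions of a linear differential equation with smooth coefficients are smooth. -/
theorem contDiffOn_linearODE_solution {A : ℝ → F →L[ℝ] F} {c d : ℝ} (hcd : c < d)
    (hA : ContDiffOn ℝ ∞ A (Icc c d)) {z : ℝ → F}
    (hz : ∀ t ∈ Icc c d, HasDerivWithinAt z (A t (z t)) (Icc c d) t) :
    ContDiffOn ℝ ∞ z (Icc c d) := by
  have hu := uniqueDiffOn_Icc hcd
  rw [contDiffOn_infty]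
  intro n
  induction n with
  | zero =>
    rw [Nat.cast_zero, contDiffOn_zero]
    exact fun t ht => (hz t ht).continuousWithinAt
  | succ n ih =>
    rw [Nat.cast_succ, contDiffOn_succ_iff_derivWithin hu]
    refine ⟨fun t ht => (hz t ht).differentiableWithinAt, by simp, ?_⟩
    -- Bootstrap: the derivative of `z` is `A z`, which is as smooth as `z` is already known to be.
    refine ((hA.of_le (by exact_mod_cast le_top)).clm_apply ih).congr fun t ht => ?_
    exact (hz t ht).derivWithin (hu t ht)

end LinearODE

/-! ### Fields of projections in a vector space and their parallel sections. -/

section ProjectionFields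

open Filter Topology

variable {F : Type*} [NormedAddCommGroup F] [NormedSpace ℝ F]

/-- The derivative `D` of a field of projections `q` satisfies the Leibniz rule for `q ∘ q = q`. -/
theorem fderiv_idempotent_apply {p : F → F →L[ℝ] F} {y : F} (hp : DifferentiableAt ℝ p y)
    (hidem : ∀ᶠ x in 𝓝 y, ∀ w, p x (p x w) = p x w) (v w : F) :
    fderiv ℝ p y v (p y w) + p y (fderiv ℝ p y v w) = fderiv ℝ p y v w := by
  have h1 : HasFDerivAt (fun x => p x (p x w))
      ((p y).comp ((fderiv ℝ p y).flip w) + (fderiv ℝ p y).flip (p y w)) y :=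
    hp.hasFDerivAt.clm_apply (hp.hasFDerivAt.clm_apply (hasFDerivAt_const w y) |>.congr_fderiv
      (by ext; simp))
  have h2 : HasFDerivAt (fun x => p x w) ((fderiv ℝ p y).flip w) y :=
    hp.hasFDerivAt.clm_apply (hasFDerivAt_const w y) |>.congr_fderiv (by ext; simp)
  have h3 := (h1.congr_of_eventuallyEq (hidem.mono fun x hx => (hx w).symm)).unique h2
  have h4 := DFunLike.congr_fun h3 v
  simp only [add_apply, ContinuousLinearMap.comp_apply,
    ContinuousLinearMap.flip_apply] at h4
  rw [add_comm]
  exact h4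

/-- The pointwise identity between the covariant derivative of the transversal component of a
variation `u` of a curve with velocity `v`, and the curvature evaluated on extensions `X`, `Y` of
`u - q u` and `v`; here `D` is the derivative of the projection field, `m` the mixed second
derivative, `a = X'[Y]` and `b = Y'[X]`. -/
theorem covDeriv_eq_bracket_of_leibniz {q : F →L[ℝ] F} {D : F →L[ℝ] F →L[ℝ] F}
    (hq : ∀ w, q (q w) = q w) (hD : ∀ v w, D v (q w) + q (D v w) = D v w) {u v m a b : F}
    (hm : D u v + q m = 0) (ha : D v (u - q u) + q a = 0) (hb : D (u - q u) v + q b = 0) :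
    D (q u) v + q (D v u + q m) = q (b - a) := by
  -- The Leibniz rule says that `D v` exchanges the image and the kernel of `q`: on the image `q D
  -- v` vanishes (`h1`), on the kernel `q D v = D v` (`h2`).
  have h1 : q (D v (q u)) = 0 := by
    have := hD v (q u)
    rw [hq] at this
    simpa using this
  have h2 : q (D v (u - q u)) = D v (u - q u) := by
    have := hD v (u - q u)
    rwa [map_sub q, hq, sub_self, map_zero, zero_add] at this
  have h3 : q m = - D u v := by rw [eq_neg_iff_add_eq_zero, add_comm]; exact hm
  have h4 : q a = - D v (u - q u) := by rw [eq_neg_iff_add_eq_zero, add_comm]; exact ha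
  have h5 : q b = - D (u - q u) v := by rw [eq_neg_iff_add_eq_zero, add_comm]; exact hb
  have h6 : q (D v u) = D v (u - q u) := by
    rw [← h2, map_sub (D v), map_sub q, h1, sub_zero]
  rw [map_add, map_sub, hq, h6, h3, h4, h5, map_sub D, sub_apply]
  abel

variable {p : F → F →L[ℝ] F} {Ω : Set F} {γ : ℝ → F} {c d : ℝ}

/-- The coefficient of the equation for the parallel sections of the image of a projection field
along a curve. -/
noncomputable def parallelCoeff (p : F → F →L[ℝ] F) (γ : ℝ → F) (S : Set ℝ) (t : ℝ) : F →L[ℝ] F :=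
  -((p (γ t)).comp (fderiv ℝ p (γ t) (derivWithin γ S t))) -
    ((fderiv ℝ p (γ t)).flip (derivWithin γ S t)).comp (p (γ t))

theorem contDiffOn_fderiv_comp (hΩ : IsOpen Ω) (hp : ContDiffOn ℝ ∞ p Ω)
    (hγ : ContDiffOn ℝ ∞ γ (Icc c d)) (hmaps : MapsTo γ (Icc c d) Ω) :
    ContDiffOn ℝ ∞ (fun t => fderiv ℝ p (γ t)) (Icc c d) :=
  (hp.fderiv_of_isOpen hΩ (by simp)).comp hγ hmaps

/-- Local existence of parallel sections of the image of a projection field, in a vector space. -/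
theorem exists_parallel_of_projectionField [CompleteSpace F] (hcd : c < d) (hΩ : IsOpen Ω)
    (hp : ContDiffOn ℝ ∞ p Ω) (hidem : ∀ y ∈ Ω, ∀ w, p y (p y w) = p y w)
    (hγ : ContDiffOn ℝ ∞ γ (Icc c d)) (hmaps : MapsTo γ (Icc c d) Ω)
    (hker : ∀ t ∈ Icc c d, p (γ t) (derivWithin γ (Icc c d) t) = 0) :
    ∃ δ > 0, ∀ c' d' : ℝ, Icc c' d' ⊆ Icc c d → c' < d' → d' - c' ≤ δ → ∀ s ∈ Icc c' d', ∀ v : F,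
      p (γ s) v = v → ∃ z : ℝ → F, z s = v ∧ ContDiffOn ℝ ∞ z (Icc c' d') ∧ ∀ t ∈ Icc c' d',
        p (γ t) (z t) = z t ∧ fderiv ℝ p (γ t) (z t) (derivWithin γ (Icc c d) t) +
          p (γ t) (derivWithin z (Icc c' d') t) = 0 := by
  have hu := uniqueDiffOn_Icc hcd
  have hpγ : ContDiffOn ℝ ∞ (fun t => p (γ t)) (Icc c d) := hp.comp hγ hmaps
  have hDγ := contDiffOn_fderiv_comp hΩ hp hγ hmaps
  have hγ' : ContDiffOn ℝ ∞ (derivWithin γ (Icc c d)) (Icc c d) := hγ.derivWithin hu (by simp)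
  have hflip : ContDiffOn ℝ ∞ (fun t => (fderiv ℝ p (γ t)).flip (derivWithin γ (Icc c d) t))
      (Icc c d) :=
    ((ContinuousLinearMap.flipₗᵢ ℝ F F F).toContinuousLinearEquiv.contDiff.comp_contDiffOn
      hDγ).clm_apply hγ'
  have hA : ContDiffOn ℝ ∞ (parallelCoeff p γ (Icc c d)) (Icc c d) :=
    ((hpγ.clm_comp (hDγ.clm_apply hγ')).neg).sub (hflip.clm_comp hpγ)
  obtain ⟨δ, hδ, H⟩ := exists_linearODE_solution hA.continuousOn
  refine ⟨δ, hδ, fun c' d' hsub hcd' hlen s hs v hv => ?_⟩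
  obtain ⟨w, hws, hw⟩ := H c' d' hsub hlen s hs v
  have hwsm := contDiffOn_linearODE_solution hcd' (hA.mono hsub) hw
  -- The solution `w` need not stay in the image of `p`; the parallel section is `p w`. In `p (p
  -- w)'`, the first term of `parallelCoeff` cancels the derivative of `p` along the curve, and the
  -- second supplies the required `-D[p w] γ'`.
  refine ⟨fun t => p (γ t) (w t), by simp only [hws, hv], (hpγ.mono hsub).clm_apply hwsm,
    fun t ht => ⟨hidem _ (hmaps (hsub ht)) _, ?_⟩⟩
  have htΩ := hmaps (hsub ht)
  have hpd : DifferentiableAt ℝ p (γ t) :=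
    (hp.contDiffAt (hΩ.mem_nhds htΩ)).differentiableAt (by simp)
  have hγd : HasDerivWithinAt γ (derivWithin γ (Icc c d) t) (Icc c' d') t :=
    ((hγ.differentiableOn (by simp) t (hsub ht)).hasDerivWithinAt).mono hsub
  have hpγd : HasDerivWithinAt (fun τ => p (γ τ))
      (fderiv ℝ p (γ t) (derivWithin γ (Icc c d) t)) (Icc c' d') t :=
    hpd.hasFDerivAt.comp_hasDerivWithinAt t hγd
  rw [(hpγd.clm_apply (hw t ht)).derivWithin (uniqueDiffOn_Icc hcd' t ht)]
  set q := p (γ t)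
  set e := derivWithin γ (Icc c d) t
  have hL := fderiv_idempotent_apply hpd
    (Filter.eventually_of_mem (hΩ.mem_nhds htΩ) hidem)
  -- The velocity `e` lies in the kernel of `p`, so by the Leibniz rule `D[·] e` lies in the image.
  have h1 : q (fderiv ℝ p (γ t) (q (w t)) e) = fderiv ℝ p (γ t) (q (w t)) e := by
    have := hL (q (w t)) e
    rwa [show p (γ t) e = 0 from hker t (hsub ht), map_zero, zero_add] at this
  have h2 : ∀ x, q (q x) = q x := hidem _ htΩ
  simp only [parallelCoeff, sub_apply, neg_apply,
    ContinuousLinearMap.comp_apply, ContinuousLinearMap.flip_apply, map_add, map_sub, map_neg]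
  change fderiv ℝ p (γ t) (q (w t)) e + (q (fderiv ℝ p (γ t) e (w t)) +
    (-q (q (q (fderiv ℝ p (γ t) e (w t)))) - q (q (fderiv ℝ p (γ t) (q (w t)) e)))) = 0
  rw [h2, h2, h1, h1]
  abel

/-- Uniqueness of parallel sections of the image of a projection field, in a vector space. -/
theorem eq_zero_of_parallel_of_projectionField (hcd : c < d) (hΩ : IsOpen Ω)
    (hp : ContDiffOn ℝ ∞ p Ω)
    (hγ : ContDiffOn ℝ ∞ γ (Icc c d)) (hmaps : MapsTo γ (Icc c d) Ω) {z : ℝ → F}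
    (hz : DifferentiableOn ℝ z (Icc c d)) (hpz : ∀ t ∈ Icc c d, p (γ t) (z t) = z t)
    (hpar : ∀ t ∈ Icc c d, fderiv ℝ p (γ t) (z t) (derivWithin γ (Icc c d) t) +
      p (γ t) (derivWithin z (Icc c d) t) = 0) {s : ℝ} (hs : s ∈ Icc c d) (hzs : z s = 0) :
    ∀ t ∈ Icc c d, z t = 0 := by
  have hu := uniqueDiffOn_Icc hcd
  have hDγ := contDiffOn_fderiv_comp hΩ hp hγ hmaps
  have hγ' : ContDiffOn ℝ ∞ (derivWithin γ (Icc c d)) (Icc c d) := hγ.derivWithin hu (by simp)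
  have hflip : ContDiffOn ℝ ∞ (fun t => (fderiv ℝ p (γ t)).flip (derivWithin γ (Icc c d) t))
      (Icc c d) :=
    ((ContinuousLinearMap.flipₗᵢ ℝ F F F).toContinuousLinearEquiv.contDiff.comp_contDiffOn
      hDγ).clm_apply hγ'
  -- Differentiating `z = p z` gives `z' = D[γ'] z + p z'`, and the parallel equation replaces `p
  -- z'` by `-D[z] γ'`. So `z` solves a linear equation solved for its derivative.
  refine linearODE_eq_zero (A := fun t => fderiv ℝ p (γ t) (derivWithin γ (Icc c d) t) -
    (fderiv ℝ p (γ t)).flip (derivWithin γ (Icc c d) t))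
    ((hDγ.clm_apply hγ').sub hflip).continuousOn (fun t ht => ?_) hs hzs
  have hpd : DifferentiableAt ℝ p (γ t) :=
    (hp.contDiffAt (hΩ.mem_nhds (hmaps ht))).differentiableAt (by simp)
  have hzd := (hz t ht).hasDerivWithinAt
  have hpγd : HasDerivWithinAt (fun τ => p (γ τ))
      (fderiv ℝ p (γ t) (derivWithin γ (Icc c d) t)) (Icc c d) t :=
    hpd.hasFDerivAt.comp_hasDerivWithinAt t
      (hγ.differentiableOn (by simp) t ht).hasDerivWithinAt
  have h1 := (hu t ht).eq_deriv _ ((hpγd.clm_apply hzd).congr (fun τ hτ => (hpz τ hτ).symm)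
    (hpz t ht).symm) hzd
  have h2 := eq_neg_of_add_eq_zero_right (hpar t ht)
  convert hzd using 1
  rw [← h1, h2]
  simp [sub_eq_add_neg]

end ProjectionFields

/-! ### Tangent coordinates in a chart and transition maps. -/

section Coordinates

open Filter Topology

variable {E : Type*} [NormedAddCommGroup E] [NormedSpace ℝ E]
  {M : Type*} [TopologicalSpace M] [ChartedSpace E M] [IsManifold 𝓘(ℝ, E) ∞ M]

instance tangentBundle_isManifold_one : IsManifold 𝓘(ℝ, E) 1 M :=
  IsManifold.of_le (n := ∞) (by simp)

/-- The coordinates of tangent vectors at `q` in the chart at `x₀`. -/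
noncomputable def tcoord (x₀ q : M) : TangentSpace 𝓘(ℝ, E) q →L[ℝ] E :=
  (trivializationAt E (TangentSpace 𝓘(ℝ, E)) x₀).continuousLinearMapAt ℝ q

/-- The tangent vector at `q` with given coordinates in the chart at `x₀`. -/
noncomputable def tcoordSymm (x₀ q : M) : E →L[ℝ] TangentSpace 𝓘(ℝ, E) q :=
  (trivializationAt E (TangentSpace 𝓘(ℝ, E)) x₀).symmL ℝ q

variable {x₀ q : M}

theorem tcoord_tcoordSymm (hq : q ∈ (chartAt E x₀).source) (w : E) :
    tcoord x₀ q (tcoordSymm x₀ q w) = w :=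
  (trivializationAt E (TangentSpace 𝓘(ℝ, E)) x₀).continuousLinearMapAt_symmL hq w

theorem tcoordSymm_tcoord (hq : q ∈ (chartAt E x₀).source) (v : TangentSpace 𝓘(ℝ, E) q) :
    tcoordSymm x₀ q (tcoord x₀ q v) = v :=
  (trivializationAt E (TangentSpace 𝓘(ℝ, E)) x₀).symmL_continuousLinearMapAt hq v

/-- Tangent vectors at `q` are stored by their components in the preferred chart at `q`. This links
the raw components in the definition of `covDeriv` with coordinates. -/
theorem tcoord_self (v : TangentSpace 𝓘(ℝ, E) q) : tcoord q q v = v := by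
  rw [tcoord, TangentBundle.continuousLinearMapAt_trivializationAt (mem_chart_source E q),
    mfderiv_extChartAt_self]
  rfl

theorem tcoord_eq_mfderiv (hq : q ∈ (chartAt E x₀).source) :
    tcoord x₀ q = mfderiv 𝓘(ℝ, E) 𝓘(ℝ, E) (extChartAt 𝓘(ℝ, E) x₀) q :=
  TangentBundle.continuousLinearMapAt_trivializationAt hq

omit [IsManifold 𝓘(ℝ, E) ∞ M] in
theorem mem_source_symm {x : M} {y : E} (hy : y ∈ (extChartAt 𝓘(ℝ, E) x).target) :
    (extChartAt 𝓘(ℝ, E) x).symm y ∈ (chartAt E x).source := by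
  rw [← extChartAt_source 𝓘(ℝ, E)]
  exact (extChartAt 𝓘(ℝ, E) x).map_target hy

theorem tcoordSymm_apply_eq_mfderiv {x : M} {y : E} (hy : y ∈ (extChartAt 𝓘(ℝ, E) x).target)
    (w : E) : tcoordSymm x ((extChartAt 𝓘(ℝ, E) x).symm y) w =
      mfderiv 𝓘(ℝ, E) 𝓘(ℝ, E) (extChartAt 𝓘(ℝ, E) x).symm y w := by
  have h := TangentBundle.symmL_trivializationAt (I := 𝓘(ℝ, E)) (mem_source_symm hy)
  rw [(extChartAt 𝓘(ℝ, E) x).right_inv hy] at h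
  rw [← mfderivWithin_univ, ← ModelWithCorners.range_eq_univ 𝓘(ℝ, E)]
  exact DFunLike.congr_fun h w

theorem trivializationAt_snd_eq_tcoord (hq : q ∈ (chartAt E x₀).source)
    (v : TangentSpace 𝓘(ℝ, E) q) :
    (trivializationAt E (TangentSpace 𝓘(ℝ, E)) x₀ ⟨q, v⟩).2 = tcoord x₀ q v := by
  rw [tcoord, Bundle.Trivialization.continuousLinearMapAt_apply,
    Bundle.Trivialization.coe_linearMapAt_of_mem _ hq]

omit [NormedSpace ℝ E] [IsManifold 𝓘(ℝ, E) ∞ M] in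
theorem chart_source_mem_nhdsWithin {X : Type*} [TopologicalSpace X] {f : X → M} {S : Set X} {t : X}
    (hf : ContinuousWithinAt f S t) (ht : f t ∈ (chartAt E x₀).source) :
    ∀ᶠ τ in 𝓝[S] t, f τ ∈ (chartAt E x₀).source :=
  hf ((chartAt E x₀).open_source.mem_nhds ht)

/-- Smoothness of a vector field along a map, in the coordinates of a chart. -/
theorem contMDiffWithinAt_lift_iff {V : Type*} [NormedAddCommGroup V] [NormedSpace ℝ V]
    {f : V → M} {Z : ∀ t, TangentSpace 𝓘(ℝ, E) (f t)}
    {S : Set V} {t : V} (htS : t ∈ S) (ht : f t ∈ (chartAt E x₀).source) :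
    ContMDiffWithinAt 𝓘(ℝ, V) 𝓘(ℝ, E).tangent ∞
      (fun τ => (⟨f τ, Z τ⟩ : TangentBundle 𝓘(ℝ, E) M)) S t ↔
    ContMDiffWithinAt 𝓘(ℝ, V) 𝓘(ℝ, E) ∞ f S t ∧
      ContDiffWithinAt ℝ ∞ (fun τ => tcoord x₀ (f τ) (Z τ)) S t := by
  rw [(trivializationAt E (TangentSpace 𝓘(ℝ, E)) x₀).contMDiffWithinAt_iff
    (by rw [Bundle.Trivialization.mem_source]; exact ht)]
  refine and_congr_right fun hf => ?_
  rw [contMDiffWithinAt_iff_contDiffWithinAt]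
  have hev := chart_source_mem_nhdsWithin hf.continuousWithinAt ht
  exact Filter.EventuallyEq.congr_contDiffWithinAt_of_mem
    (hev.mono fun τ hτ => trivializationAt_snd_eq_tcoord hτ _) htS

theorem contMDiffWithinAt_iff_coord {V : Type*} [NormedAddCommGroup V] [NormedSpace ℝ V]
    {f : V → M} {S : Set V} {t : V} (ht : f t ∈ (chartAt E x₀).source) :
    ContMDiffWithinAt 𝓘(ℝ, V) 𝓘(ℝ, E) ∞ f S t ↔ ContinuousWithinAt f S t ∧
      ContDiffWithinAt ℝ ∞ (fun τ => extChartAt 𝓘(ℝ, E) x₀ (f τ)) S t := by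
  rw [contMDiffWithinAt_iff_target_of_mem_source ht, contMDiffWithinAt_iff_contDiffWithinAt]
  rfl

theorem tcoord_mfderivWithin {V : Type*} [NormedAddCommGroup V] [NormedSpace ℝ V]
    {f : V → M} {S : Set V} {t : V} (hS : UniqueDiffWithinAt ℝ S t)
    (ht : f t ∈ (chartAt E x₀).source)
    (hf : MDifferentiableWithinAt 𝓘(ℝ, V) 𝓘(ℝ, E) f S t) (v : V) :
    tcoord x₀ (f t) (mfderivWithin 𝓘(ℝ, V) 𝓘(ℝ, E) f S t v) =
      fderivWithin ℝ (fun τ => extChartAt 𝓘(ℝ, E) x₀ (f τ)) S t v := by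
  rw [tcoord_eq_mfderiv ht, ← mfderivWithin_eq_fderivWithin]
  have := mfderiv_comp_mfderivWithin (I := 𝓘(ℝ, V)) (I' := 𝓘(ℝ, E)) (I'' := 𝓘(ℝ, E)) t
    (mdifferentiableAt_extChartAt ht) hf hS.uniqueMDiffWithinAt
  exact (DFunLike.congr_fun this v).symm

/-- The transition map from the chart at `x` to the chart at `x₀`. -/
noncomputable def transition (x x₀ : M) : E → E :=
  fun y => extChartAt 𝓘(ℝ, E) x₀ ((extChartAt 𝓘(ℝ, E) x).symm y)

theorem contDiffAt_transition {x : M} {y : E} (hy : y ∈ (extChartAt 𝓘(ℝ, E) x).target)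
    (hy' : (extChartAt 𝓘(ℝ, E) x).symm y ∈ (chartAt E x₀).source) :
    ContDiffAt ℝ ∞ (transition x x₀) y := by
  have h1 : ContMDiffAt 𝓘(ℝ, E) 𝓘(ℝ, E) ∞ (extChartAt 𝓘(ℝ, E) x₀)
    ((extChartAt 𝓘(ℝ, E) x).symm y) := contMDiffAt_extChartAt' hy'
  have h2 : ContMDiffAt 𝓘(ℝ, E) 𝓘(ℝ, E) ∞ (extChartAt 𝓘(ℝ, E) x).symm y :=
    (contMDiffOn_extChartAt_symm x).contMDiffAt ((isOpen_extChartAt_target x).mem_nhds hy)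
  exact contMDiffAt_iff_contDiffAt.1 (h1.comp y h2)

theorem fderiv_transition_apply {x : M} {y : E} (hy : y ∈ (extChartAt 𝓘(ℝ, E) x).target)
    (hy' : (extChartAt 𝓘(ℝ, E) x).symm y ∈ (chartAt E x₀).source) (w : E) :
    fderiv ℝ (transition x x₀) y w = tcoord x₀ ((extChartAt 𝓘(ℝ, E) x).symm y)
      (tcoordSymm x ((extChartAt 𝓘(ℝ, E) x).symm y) w) := by
  have h2 : MDifferentiableAt 𝓘(ℝ, E) 𝓘(ℝ, E) (extChartAt 𝓘(ℝ, E) x).symm y :=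
    ((contMDiffOn_extChartAt_symm (n := 1) x).contMDiffAt
      ((isOpen_extChartAt_target x).mem_nhds hy)).mdifferentiableAt (by simp)
  rw [tcoord_eq_mfderiv hy', tcoordSymm_apply_eq_mfderiv hy, ← mfderiv_eq_fderiv]
  have := mfderiv_comp (I := 𝓘(ℝ, E)) (I' := 𝓘(ℝ, E)) (I'' := 𝓘(ℝ, E)) y
    (mdifferentiableAt_extChartAt hy') h2
  exact DFunLike.congr_fun this w

end Coordinates

/-! ### The projection on `K` along `H` in a chart, and its smoothness. -/

section ProjectionInCoordinates

open Filter Topology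

variable {E : Type*} [NormedAddCommGroup E] [NormedSpace ℝ E]
  {M : Type*} [TopologicalSpace M] [ChartedSpace E M] [IsManifold 𝓘(ℝ, E) ∞ M]

/-- The coordinate expression, in the chart at `x₀`, of a vector field. -/
noncomputable def fieldCoord (x₀ : M) (X : ∀ q : M, TangentSpace 𝓘(ℝ, E) q) (y : E) : E :=
  tcoord x₀ ((extChartAt 𝓘(ℝ, E) x₀).symm y) (X ((extChartAt 𝓘(ℝ, E) x₀).symm y))

theorem contDiffAt_fieldCoord {x₀ : M} {X : ∀ q : M, TangentSpace 𝓘(ℝ, E) q} {y : E}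
    (hy : y ∈ (extChartAt 𝓘(ℝ, E) x₀).target)
    (hX : ContMDiffAt 𝓘(ℝ, E) 𝓘(ℝ, E).tangent ∞
      (fun q => (⟨q, X q⟩ : TangentBundle 𝓘(ℝ, E) M)) ((extChartAt 𝓘(ℝ, E) x₀).symm y)) :
    ContDiffAt ℝ ∞ (fieldCoord x₀ X) y := by
  have hs := mem_source_symm hy
  have h2 : ContMDiffAt 𝓘(ℝ, E) 𝓘(ℝ, E) ∞ (extChartAt 𝓘(ℝ, E) x₀).symm y :=
    (contMDiffOn_extChartAt_symm x₀).contMDiffAt ((isOpen_extChartAt_target x₀).mem_nhds hy)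
  have h3 := hX.comp y h2
  rw [← contDiffWithinAt_univ]
  exact ((contMDiffWithinAt_lift_iff (f := (extChartAt 𝓘(ℝ, E) x₀).symm)
    (Z := fun y => X ((extChartAt 𝓘(ℝ, E) x₀).symm y)) (mem_univ y) hs).1 h3).2

variable [FiniteDimensional ℝ E]
  {H K : ∀ p : M, Submodule ℝ (TangentSpace 𝓘(ℝ, E) p)}

/-- The projection on `K` along `H`, as an endomorphism of the tangent space. -/
noncomputable def tangentProj (h : ∀ p, IsCompl (H p) (K p)) (p : M) :
    TangentSpace 𝓘(ℝ, E) p →ₗ[ℝ] TangentSpace 𝓘(ℝ, E) p :=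
  (K p).subtype ∘ₗ projAlong (fun p => (h p).symm) p

/-- The coordinate expression, in the chart at `x₀`, of the projection on `K` along `H`. -/
noncomputable def coordProj (h : ∀ p, IsCompl (H p) (K p)) (x₀ : M) (y : E) : E →L[ℝ] E :=
  LinearMap.toContinuousLinearMap
    ((tcoord x₀ ((extChartAt 𝓘(ℝ, E) x₀).symm y)).toLinearMap ∘ₗ
      tangentProj h ((extChartAt 𝓘(ℝ, E) x₀).symm y) ∘ₗ
      (tcoordSymm x₀ ((extChartAt 𝓘(ℝ, E) x₀).symm y)).toLinearMap)

variable (h : ∀ p, IsCompl (H p) (K p))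

theorem coordProj_apply (x₀ : M) (y w : E) : coordProj h x₀ y w =
    tcoord x₀ ((extChartAt 𝓘(ℝ, E) x₀).symm y)
      (tangentProj h ((extChartAt 𝓘(ℝ, E) x₀).symm y)
        (tcoordSymm x₀ ((extChartAt 𝓘(ℝ, E) x₀).symm y) w)) := rfl

variable {x₀ q : M}

theorem coordProj_tcoord_symm {y : E} (hy : y ∈ (extChartAt 𝓘(ℝ, E) x₀).target)
    (v : TangentSpace 𝓘(ℝ, E) ((extChartAt 𝓘(ℝ, E) x₀).symm y)) :
    coordProj h x₀ y (tcoord x₀ _ v) = tcoord x₀ ((extChartAt 𝓘(ℝ, E) x₀).symm y)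
      (tangentProj h ((extChartAt 𝓘(ℝ, E) x₀).symm y) v) := by
  rw [coordProj_apply, tcoordSymm_tcoord (mem_source_symm hy)]

theorem coordProj_tcoord (hq : q ∈ (chartAt E x₀).source) (v : TangentSpace 𝓘(ℝ, E) q) :
    coordProj h x₀ (extChartAt 𝓘(ℝ, E) x₀ q) (tcoord x₀ q v) =
      tcoord x₀ q (tangentProj h q v) := by
  have h1 : extChartAt 𝓘(ℝ, E) x₀ q ∈ (extChartAt 𝓘(ℝ, E) x₀).target :=
    (extChartAt 𝓘(ℝ, E) x₀).map_source (by rwa [extChartAt_source])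
  have h2 : (extChartAt 𝓘(ℝ, E) x₀).symm (extChartAt 𝓘(ℝ, E) x₀ q) = q :=
    (extChartAt 𝓘(ℝ, E) x₀).left_inv (by rwa [extChartAt_source])
  have h3 := coordProj_tcoord_symm h h1
  rw [h2] at h3
  exact h3 v

omit [IsManifold 𝓘(ℝ, E) ∞ M] [FiniteDimensional ℝ E] in
theorem tangentProj_of_mem {p : M} {v : TangentSpace 𝓘(ℝ, E) p} (hv : v ∈ K p) :
    tangentProj h p v = v :=
  congrArg Subtype.val (Submodule.projectionOnto_apply_left (h p).symm ⟨v, hv⟩)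

omit [IsManifold 𝓘(ℝ, E) ∞ M] [FiniteDimensional ℝ E] in
theorem tangentProj_of_mem_compl {p : M} {v : TangentSpace 𝓘(ℝ, E) p} (hv : v ∈ H p) :
    tangentProj h p v = 0 :=
  congrArg Subtype.val (Submodule.projectionOnto_apply_right (h p).symm ⟨v, hv⟩)

omit [IsManifold 𝓘(ℝ, E) ∞ M] [FiniteDimensional ℝ E] in
theorem tangentProj_mem {p : M} (v : TangentSpace 𝓘(ℝ, E) p) : tangentProj h p v ∈ K p :=
  Subtype.mem _

theorem coordProj_coordProj {y : E} (hy : y ∈ (extChartAt 𝓘(ℝ, E) x₀).target) (w : E) :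
    coordProj h x₀ y (coordProj h x₀ y w) = coordProj h x₀ y w := by
  rw [coordProj_apply h x₀ y w, coordProj_tcoord_symm h hy,
    tangentProj_of_mem h (tangentProj_mem h _)]

theorem coordProj_tcoord_of_mem (hq : q ∈ (chartAt E x₀).source) {v : TangentSpace 𝓘(ℝ, E) q}
    (hv : v ∈ K q) : coordProj h x₀ (extChartAt 𝓘(ℝ, E) x₀ q) (tcoord x₀ q v) = tcoord x₀ q v := by
  rw [coordProj_tcoord h hq, tangentProj_of_mem h hv]

theorem coordProj_tcoord_of_mem_compl (hq : q ∈ (chartAt E x₀).source)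
    {v : TangentSpace 𝓘(ℝ, E) q} (hv : v ∈ H q) :
    coordProj h x₀ (extChartAt 𝓘(ℝ, E) x₀ q) (tcoord x₀ q v) = 0 := by
  rw [coordProj_tcoord h hq, tangentProj_of_mem_compl h hv, map_zero]

/-- The linear combinations of two finite families of vectors of `E`. -/
noncomputable def frameMap {r s : ℕ} (X : Fin r → E) (Y : Fin s → E) :
    ((Fin r → ℝ) × (Fin s → ℝ)) →L[ℝ] E :=
  LinearMap.toContinuousLinearMap
    ((Fintype.linearCombination ℝ X).coprod (Fintype.linearCombination ℝ Y))

omit [FiniteDimensional ℝ E] in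
theorem frameMap_apply {r s : ℕ} (X : Fin r → E) (Y : Fin s → E)
    (a : (Fin r → ℝ) × (Fin s → ℝ)) :
    frameMap X Y a = ∑ i, a.1 i • X i + ∑ j, a.2 j • Y j := by
  simp [frameMap, Fintype.linearCombination_apply]

omit [FiniteDimensional ℝ E] in
-- Frames of two complementary subspaces form together a basis: trivial intersection gives
-- injectivity and the sum gives surjectivity. Surjectivity also forces `E` to be finite
-- dimensional, so that the inverse is continuous.
theorem isInvertible_frameMap_of_isCompl {F : Type*} [AddCommGroup F] [Module ℝ F]
    {r s : ℕ} {X : Fin r → F} {Y : Fin s → F} {A B : Submodule ℝ F} (hAB : IsCompl A B)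
    (hX : LinearIndependent ℝ X) (hY : LinearIndependent ℝ Y)
    (hXA : Submodule.span ℝ (range X) = A) (hYB : Submodule.span ℝ (range Y) = B) (L : F ≃ₗ[ℝ] E) :
    (frameMap (fun i => L (X i)) (fun j => L (Y j))).IsInvertible := by
  have hmemA : ∀ a : Fin r → ℝ, ∑ i, a i • X i ∈ A := fun a =>
    hXA ▸ Submodule.sum_mem _ fun i _ =>
      Submodule.smul_mem _ _ (Submodule.subset_span (mem_range_self i))
  have hmemB : ∀ a : Fin s → ℝ, ∑ i, a i • Y i ∈ B := fun a =>
    hYB ▸ Submodule.sum_mem _ fun i _ =>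
      Submodule.smul_mem _ _ (Submodule.subset_span (mem_range_self i))
  have happ : ∀ a, frameMap (fun i => L (X i)) (fun j => L (Y j)) a =
      L (∑ i, a.1 i • X i + ∑ j, a.2 j • Y j) := by
    intro a
    simp [frameMap_apply]
  have hinj : Function.Injective (frameMap (fun i => L (X i)) (fun j => L (Y j))) := by
    rw [injective_iff_map_eq_zero]
    intro a ha
    rw [happ, LinearEquiv.map_eq_zero_iff] at ha
    have h1 : ∑ i, a.1 i • X i ∈ A ⊓ B :=
      ⟨hmemA _, by rw [eq_neg_of_add_eq_zero_left ha]; exact B.neg_mem (hmemB _)⟩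
    rw [hAB.inf_eq_bot, Submodule.mem_bot] at h1
    rw [h1, zero_add] at ha
    exact Prod.ext (funext (Fintype.linearIndependent_iff.1 hX _ h1))
      (funext (Fintype.linearIndependent_iff.1 hY _ ha))
  have hsurj : Function.Surjective (frameMap (fun i => L (X i)) (fun j => L (Y j))) := by
    intro w
    have h1 : L.symm w ∈ A ⊔ B := by rw [hAB.sup_eq_top]; trivial
    obtain ⟨x, hx, y, hy, hxy⟩ := Submodule.mem_sup.1 h1
    rw [← hXA, Submodule.mem_span_range_iff_exists_fun] at hx
    rw [← hYB, Submodule.mem_span_range_iff_exists_fun] at hy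
    obtain ⟨a, rfl⟩ := hx
    obtain ⟨b, rfl⟩ := hy
    exact ⟨(a, b), by rw [happ, hxy, L.apply_symm_apply]⟩
  have : FiniteDimensional ℝ E := Module.Finite.of_surjective
    (frameMap (fun i => L (X i)) (fun j => L (Y j))).toLinearMap hsurj
  exact ⟨(LinearEquiv.ofBijective
    (frameMap (fun i => L (X i)) (fun j => L (Y j))).toLinearMap
      ⟨hinj, hsurj⟩).toContinuousLinearEquiv, by ext <;> rfl⟩

/-- The tangent coordinates as a linear equivalence. -/
noncomputable def tcoordEquiv {x₀ q : M} (hq : q ∈ (chartAt E x₀).source) :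
    TangentSpace 𝓘(ℝ, E) q ≃ₗ[ℝ] E :=
  LinearEquiv.ofLinearMap (tcoord x₀ q).toLinearMap (tcoordSymm x₀ q).toLinearMap
    (LinearMap.ext fun w => tcoord_tcoordSymm hq w) (LinearMap.ext fun w => tcoordSymm_tcoord hq w)

/-- The coordinate expression of the projections of two supplementary smooth subbundles is
smooth. -/
theorem contDiffOn_coordProj (hH : IsSmoothSubbundle H) (hK : IsSmoothSubbundle K) (x₀ : M) :
    ContDiffOn ℝ ∞ (coordProj h x₀) (extChartAt 𝓘(ℝ, E) x₀).target := by
  intro y hy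
  refine ContDiffAt.contDiffWithinAt ?_
  set φ := extChartAt 𝓘(ℝ, E) x₀ with hφ
  obtain ⟨U, hU, hqU, r, X, hX, hXs⟩ := hH (φ.symm y)
  obtain ⟨V, hV, hqV, s, Y, hY, hYs⟩ := hK (φ.symm y)
  have hO : IsOpen φ.target := isOpen_extChartAt_target x₀
  have hW : IsOpen (φ.target ∩ φ.symm ⁻¹' (U ∩ V)) :=
    (continuousOn_extChartAt_symm x₀).isOpen_inter_preimage hO (hU.inter hV)
  set W := φ.target ∩ φ.symm ⁻¹' (U ∩ V)
  have hyW : y ∈ W := ⟨hy, hqU, hqV⟩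
  have hXc : ∀ i, ContDiffOn ℝ ∞ (fieldCoord x₀ (X i)) W := fun i y' hy' =>
    (contDiffAt_fieldCoord hy'.1
      ((hX i).contMDiffAt (hU.mem_nhds hy'.2.1))).contDiffWithinAt
  have hYc : ∀ i, ContDiffOn ℝ ∞ (fieldCoord x₀ (Y i)) W := fun i y' hy' =>
    (contDiffAt_fieldCoord hy'.1
      ((hY i).contMDiffAt (hV.mem_nhds hy'.2.2))).contDiffWithinAt
  -- The columns of `B y` are the local frames of `H` and of `K` at `y`.
  set B : E → ((Fin r → ℝ) × (Fin s → ℝ)) →L[ℝ] E := fun y =>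
    frameMap (fun i => fieldCoord x₀ (X i) y) (fun i => fieldCoord x₀ (Y i) y) with hB
  have hBs : ContDiffOn ℝ ∞ B W := by
    rw [contDiffOn_clm_apply]
    intro a
    simp only [hB, frameMap_apply]
    exact (ContDiffOn.sum fun i _ => (hXc i).const_smul _).add
      (ContDiffOn.sum fun i _ => (hYc i).const_smul _)
  have hinv : ∀ y' ∈ W, (B y').IsInvertible := fun y' hy' =>
    isInvertible_frameMap_of_isCompl (h _) (hXs _ hy'.2.1).1 (hYs _ hy'.2.2).1
      (hXs _ hy'.2.1).2 (hYs _ hy'.2.2).2 (tcoordEquiv (mem_source_symm hy'.1))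
  set pr : ((Fin r → ℝ) × (Fin s → ℝ)) →L[ℝ] ((Fin r → ℝ) × (Fin s → ℝ)) :=
    (ContinuousLinearMap.inr ℝ _ _).comp (ContinuousLinearMap.snd ℝ _ _) with hpr
  have hker : ∀ y' ∈ W, ∀ i, coordProj h x₀ y' (fieldCoord x₀ (X i) y') = 0 := by
    intro y' hy' i
    rw [fieldCoord, coordProj_tcoord_symm h hy'.1, tangentProj_of_mem_compl h, map_zero]
    rw [← (hXs _ hy'.2.1).2]
    exact Submodule.subset_span (mem_range_self i)
  have hfix : ∀ y' ∈ W, ∀ i, coordProj h x₀ y' (fieldCoord x₀ (Y i) y') =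
      fieldCoord x₀ (Y i) y' := by
    intro y' hy' i
    rw [fieldCoord, coordProj_tcoord_symm h hy'.1, tangentProj_of_mem h]
    rw [← (hYs _ hy'.2.2).2]
    exact Submodule.subset_span (mem_range_self i)
  -- In the combined frame the projection is the constant matrix `pr`, which keeps the `K`
  -- coefficients. Hence `p = B pr B⁻¹`, and inversion is smooth at invertible operators.
  have heq : ∀ y' ∈ W, coordProj h x₀ y' = (B y').comp (pr.comp (B y').inverse) := by
    intro y' hy'
    have h1 : (coordProj h x₀ y').comp (B y') = (B y').comp pr := by
      refine ContinuousLinearMap.ext fun a => ?_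
      simp only [hB, hpr, ContinuousLinearMap.comp_apply, frameMap_apply, map_add, map_sum,
        map_smul, hker y' hy', hfix y' hy']
      simp
    have h2 : (B y').comp (B y').inverse = ContinuousLinearMap.id ℝ E :=
      (hinv y' hy').self_comp_inverse
    rw [← ContinuousLinearMap.comp_assoc, ← h1, ContinuousLinearMap.comp_assoc, h2,
      ContinuousLinearMap.comp_id]
  have hBy : ContDiffAt ℝ ∞ B y := hBs.contDiffAt (hW.mem_nhds hyW)
  have hBi : ContDiffAt ℝ ∞ (fun y' => (B y').inverse) y :=
    (hinv y hyW).contDiffAt_map_inverse.comp y hBy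
  refine (hBy.clm_comp ((contDiffAt_const (c := pr)).clm_comp hBi)).congr_of_eventuallyEq ?_
  exact Filter.eventually_of_mem (hW.mem_nhds hyW) heq

end ProjectionInCoordinates

/-! ### Charts of `TM` and the covariant derivative in the preferred chart. -/

section CovariantDerivativeInCoordinates

open Filter Topology

variable {E : Type*} [NormedAddCommGroup E] [NormedSpace ℝ E]
  {M : Type*} [TopologicalSpace M] [ChartedSpace E M] [IsManifold 𝓘(ℝ, E) ∞ M]

/-- The preferred chart of `TM` at `X` depends only on the base point of `X`. Therefore `X` and its
projection `projMap h X` are read in the same chart. -/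
theorem extChartAt_tangentBundle_apply (X : TangentBundle 𝓘(ℝ, E) M) {q : M}
    (hq : q ∈ (chartAt E X.1).source) (v : TangentSpace 𝓘(ℝ, E) q) :
    extChartAt 𝓘(ℝ, E).tangent X (⟨q, v⟩ : TangentBundle 𝓘(ℝ, E) M) =
      (extChartAt 𝓘(ℝ, E) X.1 q, tcoord X.1 q v) := by
  have h1 : (trivializationAt E (TangentSpace 𝓘(ℝ, E)) X.1 ⟨q, v⟩) = (q, tcoord X.1 q v) :=
    Prod.ext (Bundle.Trivialization.coe_fst' _ hq) (trivializationAt_snd_eq_tcoord hq v)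
  rw [ModelWithCorners.tangent, FiberBundle.extChartAt]
  simp only [PartialEquiv.trans_apply, OpenPartialHomeomorph.coe_toPartialEquiv,
    Bundle.Trivialization.coe_coe, h1]
  rfl

theorem extChartAt_tangentBundle_symm_apply (X : TangentBundle 𝓘(ℝ, E) M) {y : E}
    (hy : y ∈ (extChartAt 𝓘(ℝ, E) X.1).target) (w : E) :
    (extChartAt 𝓘(ℝ, E).tangent X).symm (y, w) =
      (⟨(extChartAt 𝓘(ℝ, E) X.1).symm y, tcoordSymm X.1 _ w⟩ : TangentBundle 𝓘(ℝ, E) M) := by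
  rw [ModelWithCorners.tangent, FiberBundle.extChartAt]
  have h1 := ((trivializationAt E (TangentSpace 𝓘(ℝ, E)) X.1).mk_symm (mem_source_symm hy) w).symm
  exact h1.trans (congrArg (Bundle.TotalSpace.mk _)
    (Bundle.Trivialization.symmL_apply _ (mem_source_symm hy) w).symm)

theorem extChartAt_tangentBundle_self (X : TangentBundle 𝓘(ℝ, E) M) :
    extChartAt 𝓘(ℝ, E).tangent X X = (extChartAt 𝓘(ℝ, E) X.1 X.1, (X.2 : E)) := by
  have := extChartAt_tangentBundle_apply X (mem_chart_source E X.1) X.2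
  rwa [tcoord_self] at this

theorem hasFDerivAt_fst_prodMk_clm_apply {p : E → E →L[ℝ] E} {y : E} (hp : DifferentiableAt ℝ p y)
    (u : E) : HasFDerivAt (fun z : E × E => (z.1, p z.1 z.2))
      ((ContinuousLinearMap.fst ℝ E E).prod
        (((fderiv ℝ p y).flip u).comp (ContinuousLinearMap.fst ℝ E E) +
          (p y).comp (ContinuousLinearMap.snd ℝ E E))) (y, u) := by
  have h1 : HasFDerivAt (fun z : E × E => p z.1)
      ((fderiv ℝ p y).comp (ContinuousLinearMap.fst ℝ E E)) (y, u) :=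
    HasFDerivAt.comp (f := fun z : E × E => z.1) (y, u) hp.hasFDerivAt hasFDerivAt_fst
  refine (hasFDerivAt_fst.prodMk (h1.clm_apply hasFDerivAt_snd)).congr_fderiv ?_
  ext <;> simp

variable [FiniteDimensional ℝ E]
  {H K : ∀ p : M, Submodule ℝ (TangentSpace 𝓘(ℝ, E) p)} (h : ∀ p, IsCompl (H p) (K p))

/-- The expression of the projection of `TM` on `K` along `H` in a chart. -/
theorem continuousAt_projMap (hH : IsSmoothSubbundle H) (hK : IsSmoothSubbundle K)
    (X : TangentBundle 𝓘(ℝ, E) M) : ContinuousAt (projMap h) X := by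
  rw [FiberBundle.continuousAt_totalSpace]
  have hproj : Continuous (fun X : TangentBundle 𝓘(ℝ, E) M => X.1) :=
    FiberBundle.continuous_proj E _
  refine ⟨hproj.continuousAt, ?_⟩
  have hev : ∀ᶠ Y : TangentBundle 𝓘(ℝ, E) M in 𝓝 X, Y.1 ∈ (chartAt E X.1).source :=
    hproj.continuousAt ((chartAt E X.1).open_source.mem_nhds (mem_chart_source E X.1))
  have htriv : ContinuousAt (fun Y : TangentBundle 𝓘(ℝ, E) M =>
      (trivializationAt E (TangentSpace 𝓘(ℝ, E)) X.1 Y).2) X :=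
    ((FiberBundle.continuousAt_totalSpace E (f := id)).1 continuousAt_id).2
  have hp : ContinuousAt (coordProj h X.1) (extChartAt 𝓘(ℝ, E) X.1 X.1) :=
    (contDiffOn_coordProj h hH hK X.1).continuousOn.continuousAt
      ((isOpen_extChartAt_target X.1).mem_nhds (mem_extChartAt_target X.1))
  have hφ : ContinuousAt (fun Y : TangentBundle 𝓘(ℝ, E) M => extChartAt 𝓘(ℝ, E) X.1 Y.1) X :=
    ContinuousAt.comp (f := fun Y : TangentBundle 𝓘(ℝ, E) M => Y.1)
      (continuousAt_extChartAt X.1) hproj.continuousAt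
  have hp' : ContinuousAt (fun Y : TangentBundle 𝓘(ℝ, E) M =>
      coordProj h X.1 (extChartAt 𝓘(ℝ, E) X.1 Y.1)) X :=
    ContinuousAt.comp (f := fun Y : TangentBundle 𝓘(ℝ, E) M => extChartAt 𝓘(ℝ, E) X.1 Y.1) hp hφ
  refine (hp'.clm_apply htriv).congr ?_
  filter_upwards [hev] with Y hY
  change coordProj h X.1 _ (trivializationAt E (TangentSpace 𝓘(ℝ, E)) X.1 ⟨Y.1, Y.2⟩).2 =
    (trivializationAt E (TangentSpace 𝓘(ℝ, E)) X.1 ⟨Y.1, tangentProj h Y.1 Y.2⟩).2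
  rw [trivializationAt_snd_eq_tcoord hY, trivializationAt_snd_eq_tcoord hY, coordProj_tcoord h hY]

/-- In the chart, `P` is `(y, w) ↦ (y, p(y) w)`. Its derivative at `(y, u)` sends `(v, w')` to `(v,
D[v] u + p w')`. -/
theorem hasMFDerivAt_projMap (hH : IsSmoothSubbundle H) (hK : IsSmoothSubbundle K)
    (X : TangentBundle 𝓘(ℝ, E) M) :
    HasMFDerivAt 𝓘(ℝ, E).tangent 𝓘(ℝ, E).tangent (projMap h) X
      (show (E × E) →L[ℝ] (E × E) from
      (ContinuousLinearMap.fst ℝ E E).prod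
        (((fderiv ℝ (coordProj h X.1) (extChartAt 𝓘(ℝ, E) X.1 X.1)).flip X.2).comp
          (ContinuousLinearMap.fst ℝ E E) +
        (coordProj h X.1 (extChartAt 𝓘(ℝ, E) X.1 X.1)).comp (ContinuousLinearMap.snd ℝ E E))) := by
  refine ⟨continuousAt_projMap h hH hK X, ?_⟩
  rw [extChartAt_tangentBundle_self]
  refine HasFDerivAt.hasFDerivWithinAt ?_
  have hO := isOpen_extChartAt_target (I := 𝓘(ℝ, E)) X.1
  have hp := ((contDiffOn_coordProj h hH hK X.1).contDiffAt
    (hO.mem_nhds (mem_extChartAt_target X.1))).differentiableAt (by simp)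
  have h1 := hasFDerivAt_fst_prodMk_clm_apply hp X.2
  have h2 : (fun z : E × E => (z.1, coordProj h X.1 z.1 z.2)) =ᶠ[𝓝
      ((extChartAt 𝓘(ℝ, E) X.1 X.1, X.2) : E × E)]
      writtenInExtChartAt 𝓘(ℝ, E).tangent 𝓘(ℝ, E).tangent X (projMap h) := by
    have hnhds : (extChartAt 𝓘(ℝ, E) X.1).target ×ˢ (univ : Set E) ∈ 𝓝
        ((extChartAt 𝓘(ℝ, E) X.1 X.1, X.2) : E × E) :=
      (hO.prod isOpen_univ).mem_nhds ⟨mem_extChartAt_target X.1, mem_univ _⟩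
    filter_upwards [hnhds]
    rintro ⟨y, w⟩ ⟨hy, -⟩
    change _ = extChartAt 𝓘(ℝ, E).tangent (projMap h X)
      (projMap h ((extChartAt 𝓘(ℝ, E).tangent X).symm (y, w)))
    rw [extChartAt_tangentBundle_symm_apply X hy]
    have := extChartAt_tangentBundle_apply (projMap h X) (mem_source_symm (x := X.1) hy)
      (tangentProj h _ (tcoordSymm X.1 _ w))
    refine Eq.trans ?_ this.symm
    refine Prod.ext ?_ ?_
    · exact ((extChartAt 𝓘(ℝ, E) X.1).right_inv hy).symm
    · exact coordProj_apply h X.1 y w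
  exact h1.congr_of_eventuallyEq h2.symm

omit [FiniteDimensional ℝ E] in
theorem mfderivWithin_lift_apply {γ : ℝ → M} {Z : ∀ t, TangentSpace 𝓘(ℝ, E) (γ t)} {S : Set ℝ}
    {t : ℝ} (htS : t ∈ S) (hS : UniqueDiffWithinAt ℝ S t)
    (hZ : ContMDiffWithinAt 𝓘(ℝ, ℝ) 𝓘(ℝ, E).tangent ∞
      (fun τ => (⟨γ τ, Z τ⟩ : TangentBundle 𝓘(ℝ, E) M)) S t) :
    (mfderivWithin 𝓘(ℝ, ℝ) 𝓘(ℝ, E).tangent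
      (fun τ => (⟨γ τ, Z τ⟩ : TangentBundle 𝓘(ℝ, E) M)) S t (1 : ℝ) : E × E) =
    (derivWithin (fun τ => extChartAt 𝓘(ℝ, E) (γ t) (γ τ)) S t,
      derivWithin (fun τ => tcoord (γ t) (γ τ) (Z τ)) S t) := by
  obtain ⟨h1, h2⟩ := (contMDiffWithinAt_lift_iff htS (mem_chart_source E (γ t))).1 hZ
  have h3 := ((contMDiffWithinAt_iff_coord (mem_chart_source E (γ t))).1 h1).2
  have hev := chart_source_mem_nhdsWithin h1.continuousWithinAt (mem_chart_source E (γ t))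
  have hd := (h3.differentiableWithinAt (by simp)).hasDerivWithinAt.prodMk
    (h2.differentiableWithinAt (by simp)).hasDerivWithinAt
  obtain ⟨L, hL1, hL⟩ : ∃ L : ℝ →L[ℝ] (E × E), L 1 =
      (derivWithin (fun τ => extChartAt 𝓘(ℝ, E) (γ t) (γ τ)) S t,
        derivWithin (fun τ => tcoord (γ t) (γ τ) (Z τ)) S t) ∧
      HasFDerivWithinAt (fun τ => (extChartAt 𝓘(ℝ, E) (γ t) (γ τ), tcoord (γ t) (γ τ) (Z τ)))
        L S t := ⟨_, by simp, hd.hasFDerivWithinAt⟩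
  have hm : HasMFDerivWithinAt 𝓘(ℝ, ℝ) 𝓘(ℝ, E).tangent
      (fun τ => (⟨γ τ, Z τ⟩ : TangentBundle 𝓘(ℝ, E) M)) S t L := by
    refine ⟨hZ.continuousWithinAt, ?_⟩
    have : HasFDerivWithinAt (writtenInExtChartAt 𝓘(ℝ, ℝ) 𝓘(ℝ, E).tangent t
        (fun τ => (⟨γ τ, Z τ⟩ : TangentBundle 𝓘(ℝ, E) M))) L S t := by
      refine hL.congr_of_eventuallyEq ?_ ?_
      · exact hev.mono fun τ hτ => extChartAt_tangentBundle_apply ⟨γ t, Z t⟩ hτ (Z τ)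
      · exact extChartAt_tangentBundle_apply ⟨γ t, Z t⟩ (mem_chart_source E (γ t)) (Z t)
    have hset : (extChartAt 𝓘(ℝ, ℝ) t).symm ⁻¹' S ∩ range 𝓘(ℝ, ℝ) = S := by
      rw [extChartAt_model_space_eq_id, ModelWithCorners.range_eq_univ, inter_univ]
      rfl
    rw [← hset] at this
    exact this
  rw [hm.mfderivWithin hS.uniqueMDiffWithinAt]
  exact hL1

/-- The velocity `(x, z; e, z')` of the section is flipped to `(x, e; z, z')`. The differential of
`P` sends this to `(x, p e; z, D[z] e + p z')`, and the second flip leaves the last component alone.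
The first flip is the reason why `p` is differentiated in the direction of the section and not of
the path. -/
theorem covDeriv_eq (hH : IsSmoothSubbundle H) (hK : IsSmoothSubbundle K) {γ : ℝ → M} {a b : ℝ}
    (hab : a < b) {Z : ∀ t, K (γ t)} {t : ℝ} (ht : t ∈ Icc a b)
    (hZ : ContMDiffWithinAt 𝓘(ℝ, ℝ) 𝓘(ℝ, E).tangent ∞
      (fun τ => (⟨γ τ, (Z τ : TangentSpace 𝓘(ℝ, E) (γ τ))⟩ : TangentBundle 𝓘(ℝ, E) M))
      (Icc a b) t) :
    tcoord (γ t) (γ t) (covDeriv h γ a b Z t) =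
      fderiv ℝ (coordProj h (γ t)) (extChartAt 𝓘(ℝ, E) (γ t) (γ t))
        (tcoord (γ t) (γ t) (Z t : TangentSpace 𝓘(ℝ, E) (γ t)))
        (derivWithin (fun τ => extChartAt 𝓘(ℝ, E) (γ t) (γ τ)) (Icc a b) t) +
      coordProj h (γ t) (extChartAt 𝓘(ℝ, E) (γ t) (γ t))
        (derivWithin (fun τ => tcoord (γ t) (γ τ) (Z τ : TangentSpace 𝓘(ℝ, E) (γ τ)))
          (Icc a b) t) := by
  rw [tcoord_self, tcoord_self]
  have h1 := mfderivWithin_lift_apply ht (uniqueDiffOn_Icc hab t ht) hZ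
  set W := liftVelocity γ a b (fun τ => (Z τ : TangentSpace 𝓘(ℝ, E) (γ τ))) t with hW
  have h2 : (W.2 : E × E) = _ := h1
  have h3 := (hasMFDerivAt_projMap h hH hK (canonicalFlip W).1).mfderiv
  change ((mfderiv 𝓘(ℝ, E).tangent 𝓘(ℝ, E).tangent (projMap h) (canonicalFlip W).1
    (canonicalFlip W).2 : E × E)).2 = _
  rw [h3]
  change fderiv ℝ (coordProj h (γ t)) (extChartAt 𝓘(ℝ, E) (γ t) (γ t))
    (Z t : TangentSpace 𝓘(ℝ, E) (γ t)) (W.2 : E × E).1 +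
    coordProj h (γ t) (extChartAt 𝓘(ℝ, E) (γ t) (γ t)) (W.2 : E × E).2 = _
  rw [h2]

end CovariantDerivativeInCoordinates

/-! ### Independence of the covariant derivative from the chart. -/

section ChangeOfChart

open Filter Topology

theorem two_le_infty : (2 : ℕ∞ω) ≤ ∞ := by
  exact WithTop.coe_le_coe.2 (le_top : (2 : ℕ∞) ≤ ⊤)

/-- The local expression of the covariant derivative is compatible with a change of coordinates
`ψ`, along the curves whose velocity is in the kernel of the projection field. -/
theorem fderiv_conj_projectionField {F : Type*} [NormedAddCommGroup F] [NormedSpace ℝ F]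
    {p p₀ : F → F →L[ℝ] F} {ψ : F → F} {y : F} (hψ : ContDiffAt ℝ ∞ ψ y)
    (hp : DifferentiableAt ℝ p y) (hp₀ : DifferentiableAt ℝ p₀ (ψ y))
    (hconj : ∀ᶠ y' in 𝓝 y, ∀ v, p₀ (ψ y') (fderiv ℝ ψ y' v) = fderiv ℝ ψ y' (p y' v))
    {z z' v : F} (hv : p y v = 0) :
    fderiv ℝ p₀ (ψ y) (fderiv ℝ ψ y z) (fderiv ℝ ψ y v) +
        p₀ (ψ y) (fderiv ℝ (fderiv ℝ ψ) y v z + fderiv ℝ ψ y z') =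
      fderiv ℝ ψ y (fderiv ℝ p y z v + p y z') := by
  have hψd : HasFDerivAt ψ (fderiv ℝ ψ y) y := (hψ.differentiableAt (by simp)).hasFDerivAt
  have hψ2 : HasFDerivAt (fderiv ℝ ψ) (fderiv ℝ (fderiv ℝ ψ) y) y :=
    ((hψ.fderiv_right (m := ∞) (by simp)).differentiableAt
      (by simp)).hasFDerivAt
  -- The conjugation relation, applied to the fixed vector `v`, is differentiated on both sides and
  -- evaluated in the direction `z`. The term with `ψ''` on the right contains `p v = 0`; this is
  -- where tangency to `H` is needed.
  have h1 : HasFDerivAt (fun y' => p₀ (ψ y') (fderiv ℝ ψ y' v)) _ y :=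
    (hp₀.hasFDerivAt.comp y hψd).clm_apply (hψ2.clm_apply (hasFDerivAt_const v y))
  have h2 : HasFDerivAt (fun y' => fderiv ℝ ψ y' (p y' v)) _ y :=
    hψ2.clm_apply (hp.hasFDerivAt.clm_apply (hasFDerivAt_const v y))
  have h3 := (h1.congr_of_eventuallyEq (hconj.mono fun y' hy' => (hy' v).symm)).unique h2
  have h4 := DFunLike.congr_fun h3 z
  simp [hv] at h4
  -- The `ψ''` in the claim comes from differentiating the coordinates of the section along the
  -- curve, the one in `h4` from differentiating the relation along the section. They agree by
  -- symmetry.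
  have hsymm : fderiv ℝ (fderiv ℝ ψ) y v z = fderiv ℝ (fderiv ℝ ψ) y z v :=
    (hψ.isSymmSndFDerivAt (by simpa using two_le_infty)) v z
  have h5 : p₀ (ψ y) (fderiv ℝ ψ y z') = fderiv ℝ ψ y (p y z') := hconj.self_of_nhds z'
  rw [map_add, map_add, h5, hsymm, ← h4]
  abel

variable {E : Type*} [NormedAddCommGroup E] [NormedSpace ℝ E]
  {M : Type*} [TopologicalSpace M] [ChartedSpace E M] [IsManifold 𝓘(ℝ, E) ∞ M]
  [FiniteDimensional ℝ E]
  {H K : ∀ p : M, Submodule ℝ (TangentSpace 𝓘(ℝ, E) p)} (h : ∀ p, IsCompl (H p) (K p))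

theorem coordProj_transition {x x₀ : M} {y : E} (hy : y ∈ (extChartAt 𝓘(ℝ, E) x).target)
    (hy' : (extChartAt 𝓘(ℝ, E) x).symm y ∈ (chartAt E x₀).source) (v : E) :
    coordProj h x₀ (transition x x₀ y) (fderiv ℝ (transition x x₀) y v) =
      fderiv ℝ (transition x x₀) y (coordProj h x y v) := by
  rw [fderiv_transition_apply hy hy', fderiv_transition_apply hy hy', transition,
    coordProj_tcoord h hy', coordProj_apply, tcoordSymm_tcoord (mem_source_symm hy)]

omit [FiniteDimensional ℝ E] in
theorem fderiv_transition_extChartAt {x x₀ q : M} (hq : q ∈ (chartAt E x).source)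
    (hq' : q ∈ (chartAt E x₀).source) (v : TangentSpace 𝓘(ℝ, E) q) :
    fderiv ℝ (transition x x₀) (extChartAt 𝓘(ℝ, E) x q) (tcoord x q v) = tcoord x₀ q v := by
  have h1 : extChartAt 𝓘(ℝ, E) x q ∈ (extChartAt 𝓘(ℝ, E) x).target :=
    (extChartAt 𝓘(ℝ, E) x).map_source (by rwa [extChartAt_source])
  have h2 : (extChartAt 𝓘(ℝ, E) x).symm (extChartAt 𝓘(ℝ, E) x q) = q :=
    (extChartAt 𝓘(ℝ, E) x).left_inv (by rwa [extChartAt_source])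
  have h3 := fderiv_transition_apply (x₀ := x₀) h1 (by rwa [h2]) (tcoord x q v)
  rw [h2] at h3
  rw [h3, tcoordSymm_tcoord hq]

omit [FiniteDimensional ℝ E] [IsManifold 𝓘(ℝ, E) ∞ M] in
theorem transition_extChartAt {x x₀ q : M} (hq : q ∈ (chartAt E x).source) :
    transition x x₀ (extChartAt 𝓘(ℝ, E) x q) = extChartAt 𝓘(ℝ, E) x₀ q := by
  rw [transition, (extChartAt 𝓘(ℝ, E) x).left_inv (by rwa [extChartAt_source])]

/-- The local expression of the covariant derivative in an arbitrary chart. -/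
theorem tcoord_covDeriv (hH : IsSmoothSubbundle H) (hK : IsSmoothSubbundle K) {γ : ℝ → M}
    {a b : ℝ} (hab : a < b) {Z : ∀ t, K (γ t)} {t : ℝ} (ht : t ∈ Icc a b)
    (hZ : ContMDiffWithinAt 𝓘(ℝ, ℝ) 𝓘(ℝ, E).tangent ∞
      (fun τ => (⟨γ τ, (Z τ : TangentSpace 𝓘(ℝ, E) (γ τ))⟩ : TangentBundle 𝓘(ℝ, E) M))
      (Icc a b) t) (htan : pathVelocity γ a b t ∈ H (γ t)) {x₀ : M}
    (hx₀ : γ t ∈ (chartAt E x₀).source) :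
    tcoord x₀ (γ t) (covDeriv h γ a b Z t) =
      fderiv ℝ (coordProj h x₀) (extChartAt 𝓘(ℝ, E) x₀ (γ t))
        (tcoord x₀ (γ t) (Z t : TangentSpace 𝓘(ℝ, E) (γ t)))
        (derivWithin (fun τ => extChartAt 𝓘(ℝ, E) x₀ (γ τ)) (Icc a b) t) +
      coordProj h x₀ (extChartAt 𝓘(ℝ, E) x₀ (γ t))
        (derivWithin (fun τ => tcoord x₀ (γ τ) (Z τ : TangentSpace 𝓘(ℝ, E) (γ τ)))
          (Icc a b) t) := by
  have hx := mem_chart_source E (γ t)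
  have hu := uniqueDiffOn_Icc hab t ht
  obtain ⟨hγ, hz⟩ := (contMDiffWithinAt_lift_iff ht hx).1 hZ
  have hc := ((contMDiffWithinAt_iff_coord hx).1 hγ).2
  have hevx := chart_source_mem_nhdsWithin hγ.continuousWithinAt hx
  have hevx₀ := chart_source_mem_nhdsWithin hγ.continuousWithinAt hx₀
  set x := γ t with hxdef
  set y := extChartAt 𝓘(ℝ, E) x x with hy
  have hyt : y ∈ (extChartAt 𝓘(ℝ, E) x).target := mem_extChartAt_target x
  have hyx : (extChartAt 𝓘(ℝ, E) x).symm y = x := extChartAt_to_inv x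
  have hψ : ContDiffAt ℝ ∞ (transition x x₀) y := contDiffAt_transition hyt (by rwa [hyx])
  have hψy : transition x x₀ y = extChartAt 𝓘(ℝ, E) x₀ x := transition_extChartAt hx
  have hψt : transition x x₀ y ∈ (extChartAt 𝓘(ℝ, E) x₀).target := by
    rw [hψy]
    exact (extChartAt 𝓘(ℝ, E) x₀).map_source (by rwa [extChartAt_source])
  have hcd := (hc.differentiableWithinAt (by simp)).hasDerivWithinAt
  have hzd := (hz.differentiableWithinAt (by simp)).hasDerivWithinAt
  have hc₀ : derivWithin (fun τ => extChartAt 𝓘(ℝ, E) x₀ (γ τ)) (Icc a b) t =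
      fderiv ℝ (transition x x₀) y
        (derivWithin (fun τ => extChartAt 𝓘(ℝ, E) x (γ τ)) (Icc a b) t) := by
    have h1 := ((hψ.differentiableAt (by simp)).hasFDerivAt.comp_hasDerivWithinAt t hcd)
    refine (h1.congr_of_eventuallyEq ?_ ?_).derivWithin hu
    · exact hevx.mono fun τ hτ => (transition_extChartAt hτ).symm
    · exact (transition_extChartAt hx).symm
  -- Tangent coordinates transform by the differential of the transition map at the moving base
  -- point, hence the second derivative term.
  have hz₀ : derivWithin (fun τ => tcoord x₀ (γ τ) (Z τ : TangentSpace 𝓘(ℝ, E) (γ τ)))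
      (Icc a b) t = fderiv ℝ (fderiv ℝ (transition x x₀)) y
        (derivWithin (fun τ => extChartAt 𝓘(ℝ, E) x (γ τ)) (Icc a b) t)
        (tcoord x x (Z t : TangentSpace 𝓘(ℝ, E) x)) + fderiv ℝ (transition x x₀) y
        (derivWithin (fun τ => tcoord x (γ τ) (Z τ : TangentSpace 𝓘(ℝ, E) (γ τ)))
          (Icc a b) t) := by
    have hψ2 : HasFDerivAt (fderiv ℝ (transition x x₀))
        (fderiv ℝ (fderiv ℝ (transition x x₀)) y) y :=
      ((hψ.fderiv_right (m := ∞) (by simp)).differentiableAt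
        (by simp)).hasFDerivAt
    have h0 : HasDerivWithinAt
        (fun τ => fderiv ℝ (transition x x₀) (extChartAt 𝓘(ℝ, E) x (γ τ))) _ (Icc a b) t :=
      hψ2.comp_hasDerivWithinAt t hcd
    have h1 := h0.clm_apply hzd
    refine (h1.congr_of_eventuallyEq ?_ ?_).derivWithin hu
    · filter_upwards [hevx, hevx₀] with τ hτ hτ₀
      exact (fderiv_transition_extChartAt hτ hτ₀ _).symm
    · exact (fderiv_transition_extChartAt hx hx₀ _).symm
  have hpd : ∀ (x' : M) (y' : E), y' ∈ (extChartAt 𝓘(ℝ, E) x').target →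
      DifferentiableAt ℝ (coordProj h x') y' := fun x' y' hy' =>
    ((contDiffOn_coordProj h hH hK x').contDiffAt
      ((isOpen_extChartAt_target x').mem_nhds hy')).differentiableAt (by simp)
  have hker : coordProj h x y
      (derivWithin (fun τ => extChartAt 𝓘(ℝ, E) x (γ τ)) (Icc a b) t) = 0 := by
    have h1 := tcoord_mfderivWithin hu hx (hγ.mdifferentiableWithinAt (by simp)) (1 : ℝ)
    rw [fderivWithin_derivWithin] at h1
    rw [← h1]
    exact coordProj_tcoord_of_mem_compl h hx htan
  have hconj : ∀ᶠ y' in 𝓝 y, ∀ v, coordProj h x₀ (transition x x₀ y')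
      (fderiv ℝ (transition x x₀) y' v) = fderiv ℝ (transition x x₀) y' (coordProj h x y' v) := by
    have h1 : ∀ᶠ y' in 𝓝 y, (extChartAt 𝓘(ℝ, E) x).symm y' ∈ (chartAt E x₀).source := by
      refine ((continuousOn_extChartAt_symm x).continuousAt
        ((isOpen_extChartAt_target x).mem_nhds hyt)) ((chartAt E x₀).open_source.mem_nhds ?_)
      rwa [hyx]
    filter_upwards [h1, (isOpen_extChartAt_target x).mem_nhds hyt] with y' h1 h2 v
    exact coordProj_transition h h2 h1 v
  have hmain := fderiv_conj_projectionField hψ (hpd x y hyt)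
    (hpd x₀ _ hψt) hconj
    (z := tcoord x x (Z t : TangentSpace 𝓘(ℝ, E) x))
    (z' := derivWithin (fun τ => tcoord x (γ τ) (Z τ : TangentSpace 𝓘(ℝ, E) (γ τ))) (Icc a b) t)
    hker
  rw [hψy, fderiv_transition_extChartAt hx hx₀, ← hc₀, ← hz₀] at hmain
  rw [hmain, ← fderiv_transition_extChartAt hx hx₀]
  exact congrArg _ (covDeriv_eq h hH hK hab ht hZ)

end ChangeOfChart

/-! ### Parallel sections along a horizontal path: local existence and uniqueness. -/

section ParallelSections

open Filter Topology

variable {E : Type*} [NormedAddCommGroup E] [NormedSpace ℝ E]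
  {M : Type*} [TopologicalSpace M] [ChartedSpace E M] [IsManifold 𝓘(ℝ, E) ∞ M]

/-- `γ` is a smooth path on `[a, b]` tangent to `H`. -/
structure IsHorizontalPath (H : ∀ p : M, Submodule ℝ (TangentSpace 𝓘(ℝ, E) p)) (γ : ℝ → M)
    (a b : ℝ) : Prop where
  lt : a < b
  smooth : ContMDiffOn 𝓘(ℝ, ℝ) 𝓘(ℝ, E) ∞ γ (Icc a b)
  tangent : ∀ t ∈ Icc a b, pathVelocity γ a b t ∈ H (γ t)

variable {H K : ∀ p : M, Submodule ℝ (TangentSpace 𝓘(ℝ, E) p)} {γ : ℝ → M} {a b : ℝ}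

/-- The section `Z` of `γ^* K` is smooth near `t`. -/
def IsSmoothAlongAt (γ : ℝ → M) (a b : ℝ) (Z : ∀ t : ℝ, K (γ t)) (t : ℝ) : Prop :=
  ContMDiffWithinAt 𝓘(ℝ, ℝ) 𝓘(ℝ, E).tangent ∞
    (fun τ => (⟨γ τ, (Z τ : TangentSpace 𝓘(ℝ, E) (γ τ))⟩ : TangentBundle 𝓘(ℝ, E) M)) (Icc a b) t

/-- The section `Z` of `γ^* K` is smooth near `t` and its covariant derivative vanishes at `t`. -/
def IsParallelAt (h : ∀ p, IsCompl (H p) (K p)) (γ : ℝ → M) (a b : ℝ) (Z : ∀ t : ℝ, K (γ t))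
    (t : ℝ) : Prop :=
  IsSmoothAlongAt γ a b Z t ∧ covDeriv h γ a b Z t = 0

theorem isParallelAlong_iff (h : ∀ p, IsCompl (H p) (K p)) {Z : ∀ t : ℝ, K (γ t)} :
    IsParallelAlong h γ a b Z ↔ ∀ t ∈ Icc a b, IsParallelAt h γ a b Z t :=
  ⟨fun hZ t ht => ⟨hZ.1 t ht, hZ.2 t ht⟩, fun hZ => ⟨fun t ht => (hZ t ht).1, fun t ht =>
    (hZ t ht).2⟩⟩

/-- The coordinates, in the chart at `x₀`, of a section of `γ^* K`. -/
noncomputable def sectionCoord (x₀ : M) (γ : ℝ → M) (Z : ∀ t : ℝ, K (γ t)) (t : ℝ) : E :=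
  tcoord x₀ (γ t) (Z t : TangentSpace 𝓘(ℝ, E) (γ t))

variable (E) in
/-- The coordinates, in the chart at `x₀`, of a path. -/
noncomputable def pathCoord (x₀ : M) (γ : ℝ → M) (t : ℝ) : E :=
  extChartAt 𝓘(ℝ, E) x₀ (γ t)

variable {x₀ : M} {t : ℝ}

omit [IsManifold 𝓘(ℝ, E) ∞ M] in
theorem IsHorizontalPath.eventually_mem_source (hγ : IsHorizontalPath H γ a b) (ht : t ∈ Icc a b)
    (hx₀ : γ t ∈ (chartAt E x₀).source) : ∀ᶠ τ in 𝓝[Icc a b] t, γ τ ∈ (chartAt E x₀).source :=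
  chart_source_mem_nhdsWithin (hγ.smooth.continuousOn t ht) hx₀

theorem IsHorizontalPath.contDiffWithinAt_pathCoord (hγ : IsHorizontalPath H γ a b)
    (ht : t ∈ Icc a b) (hx₀ : γ t ∈ (chartAt E x₀).source) :
    ContDiffWithinAt ℝ ∞ (pathCoord E x₀ γ) (Icc a b) t :=
  ((contMDiffWithinAt_iff_coord hx₀).1 (hγ.smooth t ht)).2

theorem isSmoothAlongAt_iff (hγ : IsHorizontalPath H γ a b)
    {Z : ∀ t : ℝ, K (γ t)} (ht : t ∈ Icc a b) (hx₀ : γ t ∈ (chartAt E x₀).source) :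
    IsSmoothAlongAt γ a b Z t ↔ ContDiffWithinAt ℝ ∞ (sectionCoord x₀ γ Z) (Icc a b) t := by
  rw [IsSmoothAlongAt, contMDiffWithinAt_lift_iff ht hx₀]
  exact and_iff_right (hγ.smooth t ht)

omit [IsManifold 𝓘(ℝ, E) ∞ M] in
theorem pathCoord_mem_target (hx₀ : γ t ∈ (chartAt E x₀).source) :
    pathCoord E x₀ γ t ∈ (extChartAt 𝓘(ℝ, E) x₀).target :=
  (extChartAt 𝓘(ℝ, E) x₀).map_source (by rwa [extChartAt_source])

theorem tcoord_eq_zero_iff {q : M} (hq : q ∈ (chartAt E x₀).source) {v : TangentSpace 𝓘(ℝ, E) q} :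
    tcoord x₀ q v = 0 ↔ v = 0 := by
  refine ⟨fun hv => ?_, fun hv => by rw [hv, map_zero]⟩
  rw [← tcoordSymm_tcoord hq v, hv, map_zero]

variable [FiniteDimensional ℝ E] (h : ∀ p, IsCompl (H p) (K p))

theorem coordProj_sectionCoord (Z : ∀ t : ℝ, K (γ t)) (hx₀ : γ t ∈ (chartAt E x₀).source) :
    coordProj h x₀ (pathCoord E x₀ γ t) (sectionCoord x₀ γ Z t) = sectionCoord x₀ γ Z t :=
  coordProj_tcoord_of_mem h hx₀ (Z t).2

theorem IsHorizontalPath.coordProj_derivWithin (hγ : IsHorizontalPath H γ a b) (ht : t ∈ Icc a b)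
    (hx₀ : γ t ∈ (chartAt E x₀).source) :
    coordProj h x₀ (pathCoord E x₀ γ t) (derivWithin (pathCoord E x₀ γ) (Icc a b) t) = 0 := by
  have h1 := tcoord_mfderivWithin (uniqueDiffOn_Icc hγ.lt t ht) hx₀
    ((hγ.smooth t ht).mdifferentiableWithinAt (by simp)) (1 : ℝ)
  rw [fderivWithin_derivWithin] at h1
  exact (congrArg _ h1.symm).trans (coordProj_tcoord_of_mem_compl h hx₀ (hγ.tangent t ht))

theorem tcoord_covDeriv_eq (hH : IsSmoothSubbundle H) (hK : IsSmoothSubbundle K)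
    (hγ : IsHorizontalPath H γ a b) {Z : ∀ t : ℝ, K (γ t)} (ht : t ∈ Icc a b)
    (hx₀ : γ t ∈ (chartAt E x₀).source) (hZ : IsSmoothAlongAt γ a b Z t) :
    tcoord x₀ (γ t) (covDeriv h γ a b Z t) =
      fderiv ℝ (coordProj h x₀) (pathCoord E x₀ γ t) (sectionCoord x₀ γ Z t)
        (derivWithin (pathCoord E x₀ γ) (Icc a b) t) +
      coordProj h x₀ (pathCoord E x₀ γ t) (derivWithin (sectionCoord x₀ γ Z) (Icc a b) t) :=
  tcoord_covDeriv h hH hK hγ.lt ht hZ (hγ.tangent t ht) hx₀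

/-- The definition of `covDeriv` uses a chart that changes with `t`. In one fixed chart the
condition becomes a differential equation on a whole interval of times. -/
theorem isParallelAt_iff (hH : IsSmoothSubbundle H) (hK : IsSmoothSubbundle K)
    (hγ : IsHorizontalPath H γ a b) {Z : ∀ t : ℝ, K (γ t)} (ht : t ∈ Icc a b)
    (hx₀ : γ t ∈ (chartAt E x₀).source) :
    IsParallelAt h γ a b Z t ↔ ContDiffWithinAt ℝ ∞ (sectionCoord x₀ γ Z) (Icc a b) t ∧
      fderiv ℝ (coordProj h x₀) (pathCoord E x₀ γ t) (sectionCoord x₀ γ Z t)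
        (derivWithin (pathCoord E x₀ γ) (Icc a b) t) +
      coordProj h x₀ (pathCoord E x₀ γ t) (derivWithin (sectionCoord x₀ γ Z) (Icc a b) t) = 0 := by
  rw [← isSmoothAlongAt_iff hγ ht hx₀, IsParallelAt]
  refine and_congr_right fun hZ => ?_
  rw [← tcoord_covDeriv_eq h hH hK hγ ht hx₀ hZ, tcoord_eq_zero_iff hx₀]

/-- Parallelism at `t` depends only on the germ of the section within `[a, b]`; gluing rests on
this. -/
theorem IsParallelAt.congr (hH : IsSmoothSubbundle H) (hK : IsSmoothSubbundle K)
    (hγ : IsHorizontalPath H γ a b) {Z Z' : ∀ t : ℝ, K (γ t)} (ht : t ∈ Icc a b)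
    (hZ : IsParallelAt h γ a b Z t) (heq : ∀ᶠ τ in 𝓝[Icc a b] t, Z' τ = Z τ) :
    IsParallelAt h γ a b Z' t := by
  have hx := mem_chart_source E (γ t)
  rw [isParallelAt_iff h hH hK hγ ht hx] at hZ ⊢
  have h1 : sectionCoord (γ t) γ Z' =ᶠ[𝓝[Icc a b] t] sectionCoord (γ t) γ Z :=
    heq.mono fun τ hτ => by simp only [sectionCoord, hτ]
  have h2 := h1.self_of_nhdsWithin ht
  rw [h1.congr_contDiffWithinAt h2, h1.derivWithin_eq h2, h2]
  exact hZ

theorem isParallelAt_zero (hH : IsSmoothSubbundle H) (hK : IsSmoothSubbundle K)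
    (hγ : IsHorizontalPath H γ a b) (ht : t ∈ Icc a b) :
    IsParallelAt h γ a b (fun t => (0 : K (γ t))) t := by
  have hx := mem_chart_source E (γ t)
  rw [isParallelAt_iff h hH hK hγ ht hx]
  have h1 : sectionCoord (γ t) γ (fun t => (0 : K (γ t))) = fun _ => 0 := by
    funext τ
    simp [sectionCoord]
  rw [h1]
  exact ⟨contDiffWithinAt_const, by simp⟩

theorem IsParallelAt.add_smul (hH : IsSmoothSubbundle H) (hK : IsSmoothSubbundle K)
    (hγ : IsHorizontalPath H γ a b) {Z Z' : ∀ t : ℝ, K (γ t)} (ht : t ∈ Icc a b)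
    (hZ : IsParallelAt h γ a b Z t) (hZ' : IsParallelAt h γ a b Z' t) (r : ℝ) :
    IsParallelAt h γ a b (fun t => Z t + r • Z' t) t := by
  have hx := mem_chart_source E (γ t)
  rw [isParallelAt_iff h hH hK hγ ht hx] at hZ hZ' ⊢
  have h1 : sectionCoord (γ t) γ (fun t => Z t + r • Z' t) =
      sectionCoord (γ t) γ Z + r • sectionCoord (γ t) γ Z' := by
    funext τ
    simp [sectionCoord]
  have hd := (hZ.1.differentiableWithinAt (by simp)).hasDerivWithinAt
  have hd' := (hZ'.1.differentiableWithinAt (by simp)).hasDerivWithinAt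
  rw [h1, (hd.add (hd'.const_smul r)).derivWithin (uniqueDiffOn_Icc hγ.lt t ht)]
  refine ⟨hZ.1.add (hZ'.1.const_smul r), ?_⟩
  simp only [Pi.add_apply, Pi.smul_apply, map_add, map_smul, add_apply, smul_apply]
  rw [add_add_add_comm, hZ.2, zero_add, ← smul_add, hZ'.2, smul_zero]

theorem IsParallelAt.sub (hH : IsSmoothSubbundle H) (hK : IsSmoothSubbundle K)
    (hγ : IsHorizontalPath H γ a b) {Z Z' : ∀ t : ℝ, K (γ t)} (ht : t ∈ Icc a b)
    (hZ : IsParallelAt h γ a b Z t) (hZ' : IsParallelAt h γ a b Z' t) :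
    IsParallelAt h γ a b (fun t => Z t - Z' t) t := by
  have := hZ.add_smul h hH hK hγ ht hZ' (-1)
  simpa only [neg_smul, one_smul, ← sub_eq_add_neg] using this

omit [IsManifold 𝓘(ℝ, E) ∞ M] [FiniteDimensional ℝ E] in
-- Supplies nondegenerate compact intervals around `τ₀` on which the path stays in one chart. All
-- radii up to `ρ` are allowed so that the interval can be shrunk later to the length required for
-- solving the equation.
theorem IsHorizontalPath.exists_Icc_mem_source (hγ : IsHorizontalPath H γ a b) {τ₀ : ℝ}
    (hτ₀ : τ₀ ∈ Icc a b) {S : Set ℝ} (hS : S ∈ 𝓝[Icc a b] τ₀) :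
    ∃ ρ > 0, ∀ r, 0 < r → r ≤ ρ → max a (τ₀ - r) < min b (τ₀ + r) ∧
      Icc (max a (τ₀ - r)) (min b (τ₀ + r)) ⊆ Icc a b ∧
      ∀ τ ∈ Icc (max a (τ₀ - r)) (min b (τ₀ + r)), γ τ ∈ (chartAt E (γ τ₀)).source ∧ τ ∈ S := by
  have h1 := (hγ.eventually_mem_source hτ₀ (mem_chart_source E (γ τ₀))).and hS
  obtain ⟨ρ, hρ, hball⟩ := Metric.mem_nhdsWithin_iff.1 h1
  -- Halving places the closed intervals inside the open ball.
  refine ⟨ρ / 2, by positivity, fun r hr hrρ => ?_⟩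
  have hsub : Icc (max a (τ₀ - r)) (min b (τ₀ + r)) ⊆ Icc a b :=
    Icc_subset_Icc (le_max_left _ _) (min_le_left _ _)
  refine ⟨?_, hsub, fun τ hτ => ?_⟩
  · have := hγ.lt
    obtain ⟨h2, h3⟩ := hτ₀
    refine max_lt (lt_min ?_ ?_) (lt_min ?_ ?_) <;> linarith
  · refine hball ⟨?_, hsub hτ⟩
    rw [Metric.mem_ball, Real.dist_eq, abs_lt]
    have h2 := (le_max_right _ _).trans hτ.1
    have h3 := hτ.2.trans (min_le_right _ _)
    constructor <;> linarith

omit [FiniteDimensional ℝ E] in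
theorem contDiffOn_pathCoord (hγ : IsHorizontalPath H γ a b) {c d : ℝ}
    (hsub : Icc c d ⊆ Icc a b) (hsrc : ∀ τ ∈ Icc c d, γ τ ∈ (chartAt E x₀).source) :
    ContDiffOn ℝ ∞ (pathCoord E x₀ γ) (Icc c d) := fun τ hτ =>
  (hγ.contDiffWithinAt_pathCoord (hsub hτ) (hsrc τ hτ)).mono hsub

omit [FiniteDimensional ℝ E] in
theorem derivWithin_pathCoord_subset (hγ : IsHorizontalPath H γ a b) {c d : ℝ} (hcd : c < d)
    (hsub : Icc c d ⊆ Icc a b) (hsrc : ∀ τ ∈ Icc c d, γ τ ∈ (chartAt E x₀).source) (ht : t ∈ Icc c d) :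
    derivWithin (pathCoord E x₀ γ) (Icc c d) t = derivWithin (pathCoord E x₀ γ) (Icc a b) t :=
  derivWithin_subset hsub (uniqueDiffOn_Icc hcd t ht)
    ((hγ.contDiffWithinAt_pathCoord (hsub ht) (hsrc t ht)).differentiableWithinAt (by simp))

/-- A section that is parallel on a connected relatively open subset and vanishes at one of its
points vanishes on it. -/
theorem eq_zero_of_isParallelAt (hH : IsSmoothSubbundle H) (hK : IsSmoothSubbundle K)
    (hγ : IsHorizontalPath H γ a b) {O : Set ℝ} (hO : IsOpen O)
    (hconn : IsPreconnected (Icc a b ∩ O)) {Z : ∀ t : ℝ, K (γ t)}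
    (hZ : ∀ t ∈ Icc a b ∩ O, IsParallelAt h γ a b Z t) {s : ℝ} (hs : s ∈ Icc a b ∩ O)
    (hZs : Z s = 0) : ∀ t ∈ Icc a b ∩ O, Z t = 0 := by
  intro t ht
  -- Vanishing propagates along a connected set once it propagates, in both directions, between each
  -- point and its neighbours.
  refine hconn.induction₂' (fun x y => Z x = 0 → Z y = 0) (fun τ₀ hτ₀ => ?_)
    (fun x y z _ _ _ hxy hyz hx => hyz (hxy hx)) hs ht hZs
  have hOnhds : O ∈ 𝓝[Icc a b] τ₀ := mem_nhdsWithin_of_mem_nhds (hO.mem_nhds hτ₀.2)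
  obtain ⟨ρ, hρ, hJ⟩ := hγ.exists_Icc_mem_source hτ₀.1 hOnhds
  obtain ⟨hcd, hsub, hsrc⟩ := hJ ρ hρ le_rfl
  set c := max a (τ₀ - ρ)
  set d := min b (τ₀ + ρ)
  have hsrc' := fun τ hτ => (hsrc τ hτ).1
  have hτJ : τ₀ ∈ Icc c d := ⟨max_le hτ₀.1.1 (by linarith), le_min hτ₀.1.2 (by linarith)⟩
  have hpar := fun τ (hτ : τ ∈ Icc c d) => (isParallelAt_iff h hH hK hγ (hsub hτ)
    (hsrc' τ hτ)).1 (hZ τ ⟨hsub hτ, (hsrc τ hτ).2⟩)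
  -- Within one chart this is uniqueness for the linear equation of parallel sections.
  have hzero : ∀ s ∈ Icc c d, Z s = 0 → ∀ τ ∈ Icc c d, Z τ = 0 := by
    intro s hs hZs τ hτ
    have h1 := eq_zero_of_parallel_of_projectionField (p := coordProj h (γ τ₀))
      (Ω := (extChartAt 𝓘(ℝ, E) (γ τ₀)).target) (γ := pathCoord E (γ τ₀) γ)
      (z := sectionCoord (γ τ₀) γ Z) hcd
      (isOpen_extChartAt_target _) (contDiffOn_coordProj h hH hK _)
      (contDiffOn_pathCoord hγ hsub hsrc') (fun τ hτ => pathCoord_mem_target (hsrc' τ hτ))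
      (fun τ hτ => ((hpar τ hτ).1.differentiableWithinAt (by simp)).mono hsub)
      (fun τ hτ => coordProj_sectionCoord h Z (hsrc' τ hτ)) (fun τ hτ => ?_) hs
      (by simp [sectionCoord, hZs]) τ hτ
    · exact Subtype.ext ((tcoord_eq_zero_iff (hsrc' τ hτ)).1 h1)
    · rw [derivWithin_pathCoord_subset hγ hcd hsub hsrc' hτ, derivWithin_subset hsub
        (uniqueDiffOn_Icc hcd τ hτ) ((hpar τ hτ).1.differentiableWithinAt (by simp))]
      exact (hpar τ hτ).2
  have hmem : Icc c d ∈ 𝓝[Icc a b ∩ O] τ₀ := by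
    refine nhdsWithin_mono _ inter_subset_left ?_
    have : Icc (τ₀ - ρ) (τ₀ + ρ) ∈ 𝓝 τ₀ := Icc_mem_nhds (by linarith) (by linarith)
    filter_upwards [mem_nhdsWithin_of_mem_nhds this, self_mem_nhdsWithin] with τ h1 h2
    exact ⟨max_le h2.1 h1.1, le_min h2.2 h1.2⟩
  filter_upwards [hmem] with τ hτ
  exact ⟨fun h1 => hzero τ₀ hτJ h1 τ hτ, fun h1 => hzero τ hτ h1 τ₀ hτJ⟩

/-- Parallel sections exist locally. -/
theorem exists_isParallelAt_local (hH : IsSmoothSubbundle H) (hK : IsSmoothSubbundle K)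
    (hγ : IsHorizontalPath H γ a b) {τ₀ : ℝ} (hτ₀ : τ₀ ∈ Icc a b) :
    ∃ ρ > 0, ∀ s ∈ Icc a b ∩ Ioo (τ₀ - ρ) (τ₀ + ρ), ∀ v : K (γ s), ∃ Z : ∀ t : ℝ, K (γ t),
      Z s = v ∧ ∀ t ∈ Icc a b ∩ Ioo (τ₀ - ρ) (τ₀ + ρ), IsParallelAt h γ a b Z t := by
  obtain ⟨ρ, hρ, hJ⟩ := hγ.exists_Icc_mem_source hτ₀ (univ_mem (f := 𝓝[Icc a b] τ₀))
  obtain ⟨hcd, hsub, hsrc⟩ := hJ ρ hρ le_rfl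
  have hsrc' := fun τ hτ => (hsrc τ hτ).1
  obtain ⟨δ, hδ, hex⟩ := exists_parallel_of_projectionField (p := coordProj h (γ τ₀))
    (Ω := (extChartAt 𝓘(ℝ, E) (γ τ₀)).target) (γ := pathCoord E (γ τ₀) γ) hcd
    (isOpen_extChartAt_target _) (contDiffOn_coordProj h hH hK _)
    (fun y hy w => coordProj_coordProj h hy w)
    (contDiffOn_pathCoord hγ hsub hsrc') (fun τ hτ => pathCoord_mem_target (hsrc' τ hτ))
    (fun τ hτ => by
      rw [derivWithin_pathCoord_subset hγ hcd hsub hsrc' hτ]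
      exact hγ.coordProj_derivWithin h (hsub hτ) (hsrc' τ hτ))
  -- The interval of radius `r` has length at most `2r ≤ δ`, so the equation is solvable on all of
  -- it.
  set r := min ρ (δ / 2) with hr
  have hr0 : 0 < r := lt_min hρ (by positivity)
  have hrρ : r ≤ ρ := min_le_left _ _
  have hrδ : r ≤ δ / 2 := min_le_right _ _
  obtain ⟨hcd₁, hsub₁, hsrc₁⟩ := hJ r hr0 hrρ
  have hsub₂ : Icc (max a (τ₀ - r)) (min b (τ₀ + r)) ⊆ Icc (max a (τ₀ - ρ)) (min b (τ₀ + ρ)) :=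
    Icc_subset_Icc (max_le_max le_rfl (by linarith)) (min_le_min le_rfl (by linarith))
  have hlen : min b (τ₀ + r) - max a (τ₀ - r) ≤ δ := by
    have h1 := min_le_right b (τ₀ + r)
    have h2 := le_max_right a (τ₀ - r)
    linarith
  have hmemJ : ∀ t ∈ Icc a b ∩ Ioo (τ₀ - r) (τ₀ + r),
      t ∈ Icc (max a (τ₀ - r)) (min b (τ₀ + r)) := fun t ht =>
    ⟨max_le ht.1.1 ht.2.1.le, le_min ht.1.2 ht.2.2.le⟩
  refine ⟨r, hr0, fun s hs v => ?_⟩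
  have hsJ := hmemJ s hs
  obtain ⟨z, hzs, hzsm, hz⟩ := hex _ _ hsub₂ hcd₁ hlen s hsJ
    (tcoord (γ τ₀) (γ s) (v : TangentSpace 𝓘(ℝ, E) (γ s)))
    (coordProj_tcoord_of_mem h (hsrc₁ s hsJ).1 v.2)
  -- The projection makes `Z` take values in `K` at every time. On the interval it does not change
  -- the vector, since `z` lies in the image of `p` there.
  set Z : ∀ t : ℝ, K (γ t) := fun t =>
    projAlong (fun p => (h p).symm) (γ t) (tcoordSymm (γ τ₀) (γ t) (z t)) with hZ
  have hcoord : ∀ t ∈ Icc (max a (τ₀ - r)) (min b (τ₀ + r)), sectionCoord (γ τ₀) γ Z t = z t := by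
    intro t ht
    have h1 := coordProj_tcoord h (hsrc₁ t ht).1 (tcoordSymm (γ τ₀) (γ t) (z t))
    rw [tcoord_tcoordSymm (hsrc₁ t ht).1] at h1
    exact h1.symm.trans (hz t ht).1
  refine ⟨Z, ?_, fun t ht => ?_⟩
  · refine Subtype.ext ?_
    change tangentProj h (γ s) (tcoordSymm (γ τ₀) (γ s) (z s)) = v
    rw [hzs, tcoordSymm_tcoord (hsrc₁ s hsJ).1, tangentProj_of_mem h v.2]
  · have htJ := hmemJ t ht
    -- The interval is a neighbourhood of `t` within `[a, b]`, so derivatives within either set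
    -- agree.
    have hJnhds : Icc (max a (τ₀ - r)) (min b (τ₀ + r)) ∈ 𝓝[Icc a b] t := by
      filter_upwards [mem_nhdsWithin_of_mem_nhds (Ioo_mem_nhds ht.2.1 ht.2.2),
        self_mem_nhdsWithin] with τ h1 h2
      exact hmemJ τ ⟨h2, h1⟩
    have heq : sectionCoord (γ τ₀) γ Z =ᶠ[𝓝[Icc a b] t] z :=
      Filter.eventually_of_mem hJnhds hcoord
    rw [isParallelAt_iff h hH hK hγ ht.1 (hsrc₁ t htJ).1,
      heq.congr_contDiffWithinAt (hcoord t htJ), heq.derivWithin_eq (hcoord t htJ), hcoord t htJ]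
    refine ⟨(hzsm t htJ).mono_of_mem_nhdsWithin hJnhds, ?_⟩
    rw [derivWithin_of_mem_nhdsWithin hJnhds (uniqueDiffOn_Icc hγ.lt t ht.1)
      ((hzsm t htJ).differentiableWithinAt (by simp)),
      ← derivWithin_pathCoord_subset hγ hcd hsub hsrc' (hsub₂ htJ)]
    exact (hz t htJ).2

end ParallelSections

/-! ### Global parallel sections and the transport operators. -/

section ParallelTransport

open Filter Topology

variable {E : Type*} [NormedAddCommGroup E] [NormedSpace ℝ E] [FiniteDimensional ℝ E]
  {M : Type*} [TopologicalSpace M] [ChartedSpace E M] [IsManifold 𝓘(ℝ, E) ∞ M]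
  {H K : ∀ p : M, Submodule ℝ (TangentSpace 𝓘(ℝ, E) p)} {γ : ℝ → M} {a b : ℝ}
  (h : ∀ p, IsCompl (H p) (K p))

/-- Over the part of `[a, b]` in the open interval `(x, y)` there are parallel sections with
arbitrary initial values. -/
def HasParallelSections (γ : ℝ → M) (a b x y : ℝ) : Prop :=
  ∀ s ∈ Icc a b ∩ Ioo x y, ∀ v : K (γ s), ∃ Z : ∀ t : ℝ, K (γ t),
    Z s = v ∧ ∀ t ∈ Icc a b ∩ Ioo x y, IsParallelAt h γ a b Z t

variable {h}

theorem isPreconnected_Icc_inter_Ioo (a b x y : ℝ) : IsPreconnected (Icc a b ∩ Ioo x y) :=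
  (ordConnected_Icc.inter ordConnected_Ioo).isPreconnected

omit [FiniteDimensional ℝ E] in
theorem HasParallelSections.mono {x y x' y' : ℝ} (hxy : HasParallelSections h γ a b x y)
    (hsub : Icc a b ∩ Ioo x' y' ⊆ Icc a b ∩ Ioo x y) : HasParallelSections h γ a b x' y' := by
  intro s hs v
  obtain ⟨Z, hZs, hZ⟩ := hxy s (hsub hs) v
  exact ⟨Z, hZs, fun t ht => hZ t (hsub ht)⟩

theorem eqOn_of_isParallelAt (hH : IsSmoothSubbundle H) (hK : IsSmoothSubbundle K)
    (hγ : IsHorizontalPath H γ a b) {x y : ℝ} {Z Z' : ∀ t : ℝ, K (γ t)}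
    (hZ : ∀ t ∈ Icc a b ∩ Ioo x y, IsParallelAt h γ a b Z t)
    (hZ' : ∀ t ∈ Icc a b ∩ Ioo x y, IsParallelAt h γ a b Z' t) {s : ℝ}
    (hs : s ∈ Icc a b ∩ Ioo x y) (heq : Z s = Z' s) : ∀ t ∈ Icc a b ∩ Ioo x y, Z t = Z' t :=
  fun t ht => sub_eq_zero.1 (eq_zero_of_isParallelAt h hH hK hγ isOpen_Ioo
    (isPreconnected_Icc_inter_Ioo a b x y)
    (fun τ hτ => (hZ τ hτ).sub h hH hK hγ hτ.1 (hZ' τ hτ)) hs (sub_eq_zero.2 heq) t ht)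

/-- A section that is parallel over one interval is matched by a parallel section over another
one. -/
theorem HasParallelSections.exists_eqOn (hH : IsSmoothSubbundle H) (hK : IsSmoothSubbundle K)
    (hγ : IsHorizontalPath H γ a b) {x y x' y' u w : ℝ} (hxy : HasParallelSections h γ a b x y)
    (hu : Ioo u w ⊆ Ioo x y) (hu' : Ioo u w ⊆ Ioo x' y') {Z' : ∀ t : ℝ, K (γ t)}
    (hZ' : ∀ t ∈ Icc a b ∩ Ioo x' y', IsParallelAt h γ a b Z' t) :
    ∃ Z : ∀ t : ℝ, K (γ t), (∀ t ∈ Icc a b ∩ Ioo x y, IsParallelAt h γ a b Z t) ∧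
      ∀ t ∈ Icc a b ∩ Ioo u w, Z t = Z' t := by
  -- If the overlap misses `[a, b]` there is nothing to match and the zero section serves. Otherwise
  -- matching at one point suffices, by uniqueness.
  rcases (Icc a b ∩ Ioo u w).eq_empty_or_nonempty with he | ⟨m, hm⟩
  · exact ⟨fun _ => 0, fun t ht => isParallelAt_zero h hH hK hγ ht.1, by simp [he]⟩
  · obtain ⟨Z, hZm, hZ⟩ := hxy m ⟨hm.1, hu hm.2⟩ (Z' m)
    exact ⟨Z, hZ, eqOn_of_isParallelAt hH hK hγ (fun t ht => hZ t ⟨ht.1, hu ht.2⟩)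
      (fun t ht => hZ' t ⟨ht.1, hu' ht.2⟩) hm hZm⟩

/-- The sections are switched at `y`. Agreement on the overlap makes the result equal, near each
point, to one of the two: to `Z` before `y`, and to `Z'` from `y` on, because `x' < y`. -/
theorem exists_glue_isParallelAt (hH : IsSmoothSubbundle H) (hK : IsSmoothSubbundle K)
    (hγ : IsHorizontalPath H γ a b) {x x' y y' : ℝ} (hx'y : x' < y)
    {Z Z' : ∀ t : ℝ, K (γ t)}
    (hZ : ∀ t ∈ Icc a b ∩ Ioo x y, IsParallelAt h γ a b Z t)
    (hZ' : ∀ t ∈ Icc a b ∩ Ioo x' y', IsParallelAt h γ a b Z' t)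
    (heq : ∀ t ∈ Icc a b ∩ Ioo x' y, Z t = Z' t) :
    ∃ W : ∀ t : ℝ, K (γ t), (∀ t ∈ Icc a b ∩ Ioo x y', IsParallelAt h γ a b W t) ∧
      (∀ t ∈ Icc a b ∩ Ioo x y, W t = Z t) ∧ ∀ t ∈ Icc a b ∩ Ioo x' y', W t = Z' t := by
  classical
  set W : ∀ t : ℝ, K (γ t) := fun t => if t < y then Z t else Z' t with hW
  have h1 : ∀ t, t < y → W t = Z t := fun t ht => if_pos ht
  have h2 : ∀ t ∈ Icc a b ∩ Ioo x' y', W t = Z' t := by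
    intro t ht
    by_cases hty : t < y
    · rw [h1 t hty, heq t ⟨ht.1, ht.2.1, hty⟩]
    · exact if_neg hty
  refine ⟨W, fun t ht => ?_, fun t ht => h1 t ht.2.2, h2⟩
  by_cases hty : t < y
  · refine (hZ t ⟨ht.1, ht.2.1, hty⟩).congr h hH hK hγ ht.1 ?_
    exact (mem_nhdsWithin_of_mem_nhds (Iio_mem_nhds hty) : Iio y ∈ 𝓝[Icc a b] t) |>
      Filter.eventually_of_mem <| fun τ hτ => h1 τ hτ
  · have htx' : t ∈ Ioo x' y' := ⟨by linarith, ht.2.2⟩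
    refine (hZ' t ⟨ht.1, htx'⟩).congr h hH hK hγ ht.1 ?_
    filter_upwards [mem_nhdsWithin_of_mem_nhds (Ioo_mem_nhds htx'.1 htx'.2),
      self_mem_nhdsWithin] with τ hτ hτ'
    exact h2 τ ⟨hτ', hτ⟩

/-- A section prescribed over one interval is continued over the other by matching on the overlap.
The two cases say which interval contains the initial time. -/
theorem HasParallelSections.union (hH : IsSmoothSubbundle H) (hK : IsSmoothSubbundle K)
    (hγ : IsHorizontalPath H γ a b) {x x' y y' : ℝ} (hxx' : x ≤ x') (hx'y : x' < y) (hyy' : y ≤ y')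
    (hxy : HasParallelSections h γ a b x y) (hxy' : HasParallelSections h γ a b x' y') :
    HasParallelSections h γ a b x y' := by
  intro s hs v
  have hu : Ioo x' y ⊆ Ioo x y := Ioo_subset_Ioo_left hxx'
  have hu' : Ioo x' y ⊆ Ioo x' y' := Ioo_subset_Ioo_right hyy'
  by_cases hsy : s < y
  · have hs' : s ∈ Icc a b ∩ Ioo x y := ⟨hs.1, hs.2.1, hsy⟩
    obtain ⟨Z, hZs, hZ⟩ := hxy s hs' v
    obtain ⟨Z', hZ', heq⟩ := hxy'.exists_eqOn hH hK hγ hu' hu hZ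
    obtain ⟨W, hW, hWZ, -⟩ := exists_glue_isParallelAt hH hK hγ hx'y hZ hZ'
      fun t ht => (heq t ht).symm
    exact ⟨W, (hWZ s hs').trans hZs, hW⟩
  · have hs' : s ∈ Icc a b ∩ Ioo x' y' := ⟨hs.1, by linarith, hs.2.2⟩
    obtain ⟨Z', hZs', hZ'⟩ := hxy' s hs' v
    obtain ⟨Z, hZ, heq⟩ := hxy.exists_eqOn hH hK hγ hu hu' hZ'
    obtain ⟨W, hW, -, hWZ⟩ := exists_glue_isParallelAt hH hK hγ hx'y hZ hZ' heq
    exact ⟨W, (hWZ s hs').trans hZs', hW⟩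

/-- By compactness the local intervals have a common radius `δ`, a Lebesgue number of the cover.
Finitely many overlapping steps to the right then exhaust `[a, b]`. -/
theorem exists_isParallelAlong (hH : IsSmoothSubbundle H) (hK : IsSmoothSubbundle K)
    (hγ : IsHorizontalPath H γ a b) {s : ℝ} (hs : s ∈ Icc a b) (v : K (γ s)) :
    ∃ Z : ∀ t : ℝ, K (γ t), Z s = v ∧ IsParallelAlong h γ a b Z := by
  choose! ρ hρ hloc using fun τ hτ => exists_isParallelAt_local h hH hK hγ (τ₀ := τ) hτ
  obtain ⟨δ, hδ, hleb⟩ := lebesgue_number_lemma_of_metric (s := Icc a b)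
    (c := fun τ : Icc a b => Metric.ball (τ : ℝ) (ρ τ)) isCompact_Icc (fun _ => Metric.isOpen_ball)
    (fun τ hτ => mem_iUnion.2 ⟨⟨τ, hτ⟩, Metric.mem_ball_self (hρ τ hτ)⟩)
  have hunif : ∀ τ ∈ Icc a b, HasParallelSections h γ a b (τ - δ) (τ + δ) := by
    intro τ hτ
    obtain ⟨τ', hτ'⟩ := hleb τ hτ
    rw [Real.ball_eq_Ioo, Real.ball_eq_Ioo] at hτ'
    exact HasParallelSections.mono (hloc τ' τ'.2) (inter_subset_inter_right _ hτ')
  -- Each step attaches the interval of radius `δ` centred at `y - δ / 2`, where `y` is the current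
  -- right end; it overlaps the old one and advances the end by `δ / 2`. If the centre lies beyond
  -- `b`, nothing of `[a, b]` is left to cover.
  have hind : ∀ n : ℕ, HasParallelSections h γ a b (a - δ) (a + δ + n * (δ / 2)) := by
    intro n
    induction n with
    | zero => simpa using hunif a ⟨le_rfl, hγ.lt.le⟩
    | succ n ih =>
      have hn : (0 : ℝ) ≤ n * (δ / 2) := by positivity
      set y := a + δ + n * (δ / 2) with hy
      have hy' : a + δ + ((n + 1 : ℕ) : ℝ) * (δ / 2) = (y - δ / 2) + δ := by
        push_cast
        rw [hy]
        ring
      rw [hy']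
      by_cases hyb : y - δ / 2 ≤ b
      · exact ih.union hH hK hγ (by linarith) (by linarith) (by linarith)
          (hunif (y - δ / 2) ⟨by linarith, hyb⟩)
      · exact ih.mono fun t ht => ⟨ht.1, ht.2.1, by linarith [ht.1.2]⟩
  obtain ⟨n, hn⟩ := exists_nat_gt ((b - a) / (δ / 2))
  rw [div_lt_iff₀ (by positivity)] at hn
  have hall : ∀ t ∈ Icc a b, t ∈ Icc a b ∩ Ioo (a - δ) (a + δ + n * (δ / 2)) := fun t ht =>
    ⟨ht, by linarith [ht.1], by linarith [ht.2]⟩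
  obtain ⟨Z, hZs, hZ⟩ := hind n s (hall s hs) v
  exact ⟨Z, hZs, (isParallelAlong_iff h).2 fun t ht => hZ t (hall t ht)⟩

theorem IsParallelAlong.eq_of_eq (hH : IsSmoothSubbundle H) (hK : IsSmoothSubbundle K)
    (hγ : IsHorizontalPath H γ a b) {Z Z' : ∀ t : ℝ, K (γ t)} (hZ : IsParallelAlong h γ a b Z)
    (hZ' : IsParallelAlong h γ a b Z') {s t : ℝ} (hs : s ∈ Icc a b) (ht : t ∈ Icc a b)
    (heq : Z s = Z' s) : Z t = Z' t := by
  rw [isParallelAlong_iff] at hZ hZ'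
  have hmem : ∀ t ∈ Icc a b, t ∈ Icc a b ∩ Ioo (a - 1) (b + 1) := fun t ht =>
    ⟨ht, by linarith [ht.1], by linarith [ht.2]⟩
  exact eqOn_of_isParallelAt hH hK hγ (fun τ hτ => hZ τ hτ.1) (fun τ hτ => hZ' τ hτ.1)
    (hmem s hs) heq t (hmem t ht)

/-- Parallel transport maps the initial value of a parallel section to its value. -/
theorem parallelTransport_apply (hH : IsSmoothSubbundle H) (hK : IsSmoothSubbundle K)
    (hγ : IsHorizontalPath H γ a b) {Z : ∀ t : ℝ, K (γ t)} (hZ : IsParallelAlong h γ a b Z)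
    {s t : ℝ} (hs : s ∈ Icc a b) (ht : t ∈ Icc a b) :
    parallelTransport h γ a b s t (Z s) = Z t := by
  have hex : ∃ L : K (γ s) →ₗ[ℝ] K (γ t), ∀ v : K (γ s),
      ∃ Z : ∀ τ : ℝ, K (γ τ), IsParallelAlong h γ a b Z ∧ Z s = v ∧ Z t = L v := by
    choose W hWs hW using fun v => exists_isParallelAlong (h := h) hH hK hγ hs v
    -- Both sides are values at `t` of parallel sections with the same value at `s`, so linearity
    -- follows from uniqueness.
    have hlin : ∀ (v w : K (γ s)) (r : ℝ), W (v + r • w) t = W v t + r • W w t := by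
      intro v w r
      have hsum : IsParallelAlong h γ a b (fun τ => W v τ + r • W w τ) := by
        rw [isParallelAlong_iff]
        exact fun τ hτ => ((isParallelAlong_iff h).1 (hW v) τ hτ).add_smul h hH hK hγ hτ
          ((isParallelAlong_iff h).1 (hW w) τ hτ) r
      exact (hW _).eq_of_eq hH hK hγ hsum hs ht (by simp only [hWs])
    have hzero : W 0 t = 0 := by
      have := hlin 0 0 1
      simpa using this
    refine ⟨{ toFun := fun v => W v t, map_add' := fun v w => ?_, map_smul' := fun r v => ?_ },
      fun v => ⟨W v, hW v, hWs v, rfl⟩⟩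
    · simpa using hlin v w 1
    · have := hlin 0 v r
      rwa [hzero, zero_add, zero_add] at this
  rw [parallelTransport, dif_pos hex]
  -- Uniqueness again: any operator that the definition may have chosen has the same values.
  obtain ⟨Z', hZ', hs', ht'⟩ := hex.choose_spec (Z s)
  rw [← ht']
  exact hZ'.eq_of_eq hH hK hγ hZ hs ht hs'

theorem parallelTransport_self (hH : IsSmoothSubbundle H) (hK : IsSmoothSubbundle K)
    (hγ : IsHorizontalPath H γ a b) {s : ℝ} (hs : s ∈ Icc a b) (v : K (γ s)) :
    parallelTransport h γ a b s s v = v := by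
  obtain ⟨Z, rfl, hZ⟩ := exists_isParallelAlong (h := h) hH hK hγ hs v
  exact parallelTransport_apply hH hK hγ hZ hs hs

theorem parallelTransport_trans (hH : IsSmoothSubbundle H) (hK : IsSmoothSubbundle K)
    (hγ : IsHorizontalPath H γ a b) {s t u : ℝ} (hs : s ∈ Icc a b) (ht : t ∈ Icc a b)
    (hu : u ∈ Icc a b) (v : K (γ s)) :
    parallelTransport h γ a b t u (parallelTransport h γ a b s t v) =
      parallelTransport h γ a b s u v := by
  obtain ⟨Z, rfl, hZ⟩ := exists_isParallelAlong (h := h) hH hK hγ hs v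
  simp only [parallelTransport_apply hH hK hγ hZ hs ht, parallelTransport_apply hH hK hγ hZ ht hu,
    parallelTransport_apply hH hK hγ hZ hs hu]

/-- The transported vector agrees with a parallel section only on `[a, b]`. This is enough, since
smoothness and derivatives are taken within that interval. -/
theorem isParallelAt_parallelTransport (hH : IsSmoothSubbundle H) (hK : IsSmoothSubbundle K)
    (hγ : IsHorizontalPath H γ a b) {s : ℝ} (hs : s ∈ Icc a b) (v : K (γ s)) {t : ℝ}
    (ht : t ∈ Icc a b) : IsParallelAt h γ a b (fun τ => parallelTransport h γ a b s τ v) t := by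
  obtain ⟨Z, rfl, hZ⟩ := exists_isParallelAlong (h := h) hH hK hγ hs v
  refine ((isParallelAlong_iff h).1 hZ t ht).congr h hH hK hγ ht ?_
  filter_upwards [self_mem_nhdsWithin] with τ hτ
  exact parallelTransport_apply hH hK hγ hZ hs hτ

end ParallelTransport

/-! ### The derivative of a transported section is the transported covariant derivative. -/

section TransportDerivative

open Filter Topology

variable {E : Type*} [NormedAddCommGroup E] [NormedSpace ℝ E] [FiniteDimensional ℝ E]

/-- If `z = A g` for a differentiable family `A` of linear maps with `A t = 1`, then `g` is
differentiable and its derivative is given by the product rule. -/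
theorem hasDerivWithinAt_of_clm_apply_eq {A : ℝ → E →L[ℝ] E} {A' : E →L[ℝ] E} {g z : ℝ → E} {z' : E}
    {S : Set ℝ} {t : ℝ} (htS : t ∈ S) (hS : UniqueDiffWithinAt ℝ S t)
    (hA : HasDerivWithinAt A A' S t)
    (hAt : A t = ContinuousLinearMap.id ℝ E) (hz : HasDerivWithinAt z z' S t)
    (heq : ∀ᶠ τ in 𝓝[S] t, A τ (g τ) = z τ) : HasDerivWithinAt g (z' - A' (g t)) S t := by
  have hinvt : A t = ((ContinuousLinearEquiv.refl ℝ E : E ≃L[ℝ] E) : E →L[ℝ] E) := hAt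
  -- Since `A t` is the identity, `A τ` is invertible for `τ` near `t`. So `g = A⁻¹ z` is
  -- differentiable, after which the product rule for `A g = z` determines its derivative.
  have hinv : DifferentiableWithinAt ℝ (fun τ => (A τ).inverse) S t := by
    have h1 : ContDiffAt ℝ ∞ (ContinuousLinearMap.inverse : (E →L[ℝ] E) → E →L[ℝ] E) (A t) := by
      rw [hinvt]
      exact contDiffAt_map_inverse _
    exact (h1.differentiableAt (by simp)).comp_differentiableWithinAt t hA.differentiableWithinAt
  have hev : ∀ᶠ τ in 𝓝[S] t, g τ = (A τ).inverse (z τ) := by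
    have h1 : ∀ᶠ τ in 𝓝[S] t, A τ ∈ range ((↑) : (E ≃L[ℝ] E) → E →L[ℝ] E) := by
      refine hA.continuousWithinAt.eventually ?_
      rw [hinvt]
      exact ContinuousLinearEquiv.nhds _
    filter_upwards [h1, heq] with τ h1 h2
    obtain ⟨L, hL⟩ := h1
    rw [← h2, ← hL, ContinuousLinearMap.inverse_equiv]
    simp
  have hg : DifferentiableWithinAt ℝ g S t :=
    (hinv.clm_apply hz.differentiableWithinAt).congr_of_eventuallyEq hev
      (hev.self_of_nhdsWithin htS)
  have h1 := (hA.clm_apply hg.hasDerivWithinAt).congr_of_eventuallyEq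
    (heq.mono fun τ hτ => hτ.symm) (heq.self_of_nhdsWithin htS).symm
  have h2 := hS.eq_deriv _ hz h1
  have h3 : derivWithin g S t = z' - A' (g t) := by
    rw [h2, hAt, ContinuousLinearMap.id_apply]
    abel
  rw [← h3]
  exact hg.hasDerivWithinAt

variable {M : Type*} [TopologicalSpace M] [ChartedSpace E M] [IsManifold 𝓘(ℝ, E) ∞ M]
  {H K : ∀ p : M, Submodule ℝ (TangentSpace 𝓘(ℝ, E) p)} {γ : ℝ → M} {a b : ℝ}
  {h : ∀ p, IsCompl (H p) (K p)}

/-- The family of linear maps of `E` that represents parallel transport in a chart on `K`, and is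
constant on `H`. -/
noncomputable def transportCoord (h : ∀ p, IsCompl (H p) (K p)) (γ : ℝ → M) (a b t τ : ℝ) :
    E →L[ℝ] E :=
  LinearMap.toContinuousLinearMap
    ((tcoord (γ t) (γ τ)).toLinearMap ∘ₗ (K (γ τ)).subtype ∘ₗ
      parallelTransport h γ a b t τ ∘ₗ projAlong (fun p => (h p).symm) (γ t) ∘ₗ
      (tcoordSymm (γ t) (γ t)).toLinearMap +
    (LinearMap.id - (coordProj h (γ t) (pathCoord E (γ t) γ t)).toLinearMap))

theorem transportCoord_apply (h : ∀ p, IsCompl (H p) (K p)) (γ : ℝ → M) (a b t τ : ℝ) (e : E) :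
    transportCoord h γ a b t τ e = sectionCoord (γ t) γ (fun τ => parallelTransport h γ a b t τ
      (projAlong (fun p => (h p).symm) (γ t) (tcoordSymm (γ t) (γ t) e))) τ +
      (e - coordProj h (γ t) (pathCoord E (γ t) γ t) e) := rfl

omit [FiniteDimensional ℝ E] [IsManifold 𝓘(ℝ, E) ∞ M] in
theorem projAlong_symm_coe (h : ∀ p, IsCompl (H p) (K p)) {p : M} (v : K p) : projAlong (fun p => (h p).symm) p v = v :=
  Submodule.projectionOnto_apply_left (h p).symm v

theorem transportCoord_sectionCoord {t : ℝ} (τ : ℝ) (Z : ∀ t : ℝ, K (γ t)) :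
    transportCoord h γ a b t τ (sectionCoord (γ t) γ Z t) =
      sectionCoord (γ t) γ (fun τ => parallelTransport h γ a b t τ (Z t)) τ := by
  have hx := mem_chart_source E (γ t)
  rw [transportCoord_apply, coordProj_sectionCoord h Z hx, sub_self, add_zero]
  have h1 : tcoordSymm (γ t) (γ t) (sectionCoord (γ t) γ Z t) = (Z t : TangentSpace 𝓘(ℝ, E) (γ t)) :=
    tcoordSymm_tcoord hx _
  rw [h1, projAlong_symm_coe h]

/-- Let `g` be the section carried back to time `t`, so that transporting `g τ` from `t` to `τ`
recovers `Z τ`. The product rule gives `g' = z' - ζ'` at `t`, with `ζ` the parallel section through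
`Z t`. As `g` stays in the fixed space `K` at `γ t`, one has `g' = p g' = p z' - p ζ'`, and the
parallel equation for `ζ` turns this into the local formula for the covariant derivative. -/
theorem hasDerivWithinAt_parallelTransport_self (hH : IsSmoothSubbundle H)
    (hK : IsSmoothSubbundle K) (hγ : IsHorizontalPath H γ a b) {Z : ∀ t : ℝ, K (γ t)} {t : ℝ}
    (ht : t ∈ Icc a b) (hZ : IsSmoothAlongAt γ a b Z t) :
    HasDerivWithinAt (fun τ : ℝ => tcoord (γ t) (γ t)
        (parallelTransport h γ a b τ t (Z τ) : TangentSpace 𝓘(ℝ, E) (γ t)))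
      (tcoord (γ t) (γ t) (covDeriv h γ a b Z t)) (Icc a b) t := by
  have hx := mem_chart_source E (γ t)
  have hu := uniqueDiffOn_Icc hγ.lt t ht
  set c : E := pathCoord E (γ t) γ t with hc
  set p : E →L[ℝ] E := coordProj h (γ t) c with hp
  set g : ℝ → E := fun τ : ℝ => tcoord (γ t) (γ t)
    (parallelTransport h γ a b τ t (Z τ) : TangentSpace 𝓘(ℝ, E) (γ t)) with hg
  set S := Icc a b ∩ {τ | γ τ ∈ (chartAt E (γ t)).source} with hS
  have hSev : S ∈ 𝓝[Icc a b] t :=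
    Filter.inter_mem self_mem_nhdsWithin (hγ.eventually_mem_source ht hx)
  set A : ℝ → E →L[ℝ] E := transportCoord h γ a b t with hA
  have hpar : ∀ v : K (γ t), ∀ τ ∈ S, ContDiffWithinAt ℝ ∞
      (sectionCoord (γ t) γ (fun τ => parallelTransport h γ a b t τ v)) (Icc a b) τ := fun v τ hτ =>
    ((isParallelAt_iff h hH hK hγ hτ.1 hτ.2).1
      (isParallelAt_parallelTransport hH hK hγ ht v hτ.1)).1
  -- In finite dimension the smoothness of an operator family is tested on vectors, where it becomes
  -- that of a parallel section plus a constant.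
  have hAs : ContDiffOn ℝ ∞ A S := by
    rw [contDiffOn_clm_apply]
    intro e τ hτ
    exact ((hpar _ τ hτ).mono inter_subset_left).add contDiffWithinAt_const
  have hAd : DifferentiableWithinAt ℝ A (Icc a b) t :=
    ((hAs t ⟨ht, hx⟩).mono_of_mem_nhdsWithin hSev).differentiableWithinAt (by simp)
  have hAt : A t = ContinuousLinearMap.id ℝ E := by
    refine ContinuousLinearMap.ext fun e => ?_
    rw [hA, transportCoord_apply]
    have h1 : sectionCoord (γ t) γ (fun τ => parallelTransport h γ a b t τ
        (projAlong (fun p => (h p).symm) (γ t) (tcoordSymm (γ t) (γ t) e))) t = p e := by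
      rw [sectionCoord, parallelTransport_self hH hK hγ ht]
      have h2 := coordProj_tcoord h hx (tcoordSymm (γ t) (γ t) e)
      rw [tcoord_tcoordSymm hx] at h2
      exact h2.symm
    rw [h1, ContinuousLinearMap.id_apply]
    exact add_sub_cancel _ _
  have hAg : ∀ τ ∈ Icc a b, A τ (g τ) = sectionCoord (γ t) γ Z τ := by
    intro τ hτ
    have h1 := transportCoord_sectionCoord (h := h) (a := a) (b := b) (t := t) τ
      (fun σ => parallelTransport h γ a b τ σ (Z τ))
    refine h1.trans ?_
    simp only [sectionCoord, parallelTransport_trans hH hK hγ hτ ht hτ,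
      parallelTransport_self hH hK hγ hτ]
  have hzd := (((isSmoothAlongAt_iff hγ ht hx).1 hZ).differentiableWithinAt
    (by simp)).hasDerivWithinAt
  have hgt : g t = sectionCoord (γ t) γ Z t := by
    simp only [hg, parallelTransport_self hH hK hγ ht, sectionCoord]
  have hder := hasDerivWithinAt_of_clm_apply_eq ht hu hAd.hasDerivWithinAt hAt hzd
    (Filter.eventually_of_mem self_mem_nhdsWithin hAg)
  set A' := derivWithin A (Icc a b) t
  set ζ : ∀ τ : ℝ, K (γ τ) := fun τ => parallelTransport h γ a b t τ (Z t) with hζ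
  have hζpar := (isParallelAt_iff h hH hK hγ ht hx).1
    (isParallelAt_parallelTransport (h := h) hH hK hγ ht (Z t) ht)
  have hζt : sectionCoord (γ t) γ ζ t = sectionCoord (γ t) γ Z t := by
    simp only [sectionCoord, hζ, parallelTransport_self hH hK hγ ht]
  have hA'g : A' (g t) = derivWithin (sectionCoord (γ t) γ ζ) (Icc a b) t := by
    have h1 := hAd.hasDerivWithinAt.clm_apply (hasDerivWithinAt_const t (Icc a b) (g t))
    rw [map_zero, add_zero] at h1
    refine (h1.derivWithin hu).symm.trans ?_
    congr 1
    funext τ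
    rw [hgt]
    exact transportCoord_sectionCoord τ Z
  -- Here `p` is the projection at the fixed point `γ t`, hence a constant operator that fixes every
  -- `g τ`.
  have hpg : p (derivWithin g (Icc a b) t) = derivWithin g (Icc a b) t := by
    have h1 : HasDerivWithinAt (fun τ => p (g τ)) (p (derivWithin g (Icc a b) t)) (Icc a b) t :=
      p.hasFDerivAt.comp_hasDerivWithinAt t hder.differentiableWithinAt.hasDerivWithinAt
    refine hu.eq_deriv _ (h1.congr (fun τ _ => ?_) ?_)
      hder.differentiableWithinAt.hasDerivWithinAt
    · exact (coordProj_tcoord_of_mem h hx (Subtype.mem _)).symm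
    · exact (coordProj_tcoord_of_mem h hx (Subtype.mem _)).symm
  rw [hder.derivWithin hu, hA'g] at hpg
  rw [hA'g] at hder
  convert hder using 1
  rw [tcoord_covDeriv_eq h hH hK hγ ht hx hZ, ← hpg, map_sub, ← hζt]
  have h2 := hζpar.2
  rw [add_eq_zero_iff_eq_neg] at h2
  rw [h2]
  abel

/-- Transport from `τ` to `t₀` passes through `t`, so the case `t₀ = t` is composed with one fixed
linear map. That map is the transport from `t` to `t₀`, extended to the whole model space by the
projection on `K`. -/
theorem hasDerivWithinAt_parallelTransport (hH : IsSmoothSubbundle H)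
    (hK : IsSmoothSubbundle K) (hγ : IsHorizontalPath H γ a b) {Z : ∀ t : ℝ, K (γ t)} {t t₀ : ℝ}
    (ht : t ∈ Icc a b) (ht₀ : t₀ ∈ Icc a b) (hZ : IsSmoothAlongAt γ a b Z t) {C : K (γ t)}
    (hC : covDeriv h γ a b Z t = C) :
    HasDerivWithinAt (fun τ : ℝ =>
        (parallelTransport h γ a b τ t₀ (Z τ) : TangentSpace 𝓘(ℝ, E) (γ t₀)))
      (parallelTransport h γ a b t t₀ C : TangentSpace 𝓘(ℝ, E) (γ t₀)) (Icc a b) t := by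
  have h1 := hasDerivWithinAt_parallelTransport_self (h := h) hH hK hγ ht hZ
  have hx := mem_chart_source E (γ t)
  set L : E →ₗ[ℝ] E := (tcoord (γ t₀) (γ t₀)).toLinearMap ∘ₗ (K (γ t₀)).subtype ∘ₗ
      parallelTransport h γ a b t t₀ ∘ₗ projAlong (fun p => (h p).symm) (γ t) ∘ₗ
      (tcoordSymm (γ t) (γ t)).toLinearMap with hL
  have hLK : ∀ v : K (γ t), L (tcoord (γ t) (γ t) (v : TangentSpace 𝓘(ℝ, E) (γ t))) =
      (parallelTransport h γ a b t t₀ v : TangentSpace 𝓘(ℝ, E) (γ t₀)) := by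
    intro v
    have h2 : L (tcoord (γ t) (γ t) (v : TangentSpace 𝓘(ℝ, E) (γ t))) = tcoord (γ t₀) (γ t₀)
        (parallelTransport h γ a b t t₀ (projAlong (fun p => (h p).symm) (γ t)
          (tcoordSymm (γ t) (γ t) (tcoord (γ t) (γ t) (v : TangentSpace 𝓘(ℝ, E) (γ t))))) :
            TangentSpace 𝓘(ℝ, E) (γ t₀)) := rfl
    rw [h2, tcoordSymm_tcoord hx, projAlong_symm_coe h, tcoord_self]
  have h3 := (LinearMap.toContinuousLinearMap L).hasFDerivAt.comp_hasDerivWithinAt t h1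
  rw [hC] at h3
  have h4 : HasDerivWithinAt (fun τ : ℝ =>
      ((parallelTransport h γ a b τ t₀ (Z τ) : TangentSpace 𝓘(ℝ, E) (γ t₀)) : E))
      ((parallelTransport h γ a b t t₀ C : TangentSpace 𝓘(ℝ, E) (γ t₀)) : E) (Icc a b) t := by
    have h5 : ∀ τ ∈ Icc a b,
        ((parallelTransport h γ a b τ t₀ (Z τ) : TangentSpace 𝓘(ℝ, E) (γ t₀)) : E) =
        (LinearMap.toContinuousLinearMap L ∘ fun τ => tcoord (γ t) (γ t)
          (parallelTransport h γ a b τ t (Z τ) : TangentSpace 𝓘(ℝ, E) (γ t))) τ := by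
      intro τ hτ
      refine Eq.trans ?_ (hLK (parallelTransport h γ a b τ t (Z τ))).symm
      rw [parallelTransport_trans hH hK hγ hτ ht ht₀]
    have h6 := h3.congr h5 (h5 t ht)
    have h7 : LinearMap.toContinuousLinearMap L (tcoord (γ t) (γ t) (C : TangentSpace 𝓘(ℝ, E) (γ t)))
      = _ := hLK C
    rw [h7] at h6
    exact h6
  exact h4

end TransportDerivative

/-! ### Second derivatives of a two parameter family in a vector space. -/

section VariationInVectorSpace

open Filter Topology

variable {E : Type*} [NormedAddCommGroup E] [NormedSpace ℝ E]

/-- The derivative, along a curve `c`, of a family of linear maps `p` applied to a component of the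
differential of `F`. -/
theorem hasDerivWithinAt_clm_apply_fderivWithin {V : Type*} [NormedAddCommGroup V] [NormedSpace ℝ V]
    {F : V → E} {p : E → E →L[ℝ] E} {S : Set V} {T : Set ℝ} {c : ℝ → V} {c' : V} {t : ℝ}
    (hF : DifferentiableWithinAt ℝ F S (c t))
    (hG : DifferentiableWithinAt ℝ (fderivWithin ℝ F S) S (c t))
    (hp : DifferentiableAt ℝ p (F (c t))) (hc : HasDerivWithinAt c c' T t) (hcT : MapsTo c T S)
    (e : V) :
    HasDerivWithinAt (fun τ => p (F (c τ)) (fderivWithin ℝ F S (c τ) e))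
      (fderiv ℝ p (F (c t)) (fderivWithin ℝ F S (c t) c') (fderivWithin ℝ F S (c t) e) +
        p (F (c t)) (fderivWithin ℝ (fderivWithin ℝ F S) S (c t) c' e)) T t := by
  have h1 : HasDerivWithinAt (fun τ => F (c τ)) (fderivWithin ℝ F S (c t) c') T t :=
    hF.hasFDerivWithinAt.comp_hasDerivWithinAt t hc hcT
  have h2 : HasDerivWithinAt (fun τ => fderivWithin ℝ F S (c τ))
      (fderivWithin ℝ (fderivWithin ℝ F S) S (c t) c') T t :=
    hG.hasFDerivWithinAt.comp_hasDerivWithinAt t hc hcT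
  have h3 : HasDerivWithinAt (fun τ => p (F (c τ)))
      (fderiv ℝ p (F (c t)) (fderivWithin ℝ F S (c t) c')) T t :=
    hp.hasFDerivAt.comp_hasDerivWithinAt t h1
  have h4 : HasDerivWithinAt (fun τ => fderivWithin ℝ F S (c τ) e)
      (fderivWithin ℝ (fderivWithin ℝ F S) S (c t) c' e) T t :=
    (ContinuousLinearMap.apply ℝ E e).hasFDerivAt.comp_hasDerivWithinAt t h2
  exact h3.clm_apply h4

/-- For a two parameter family `F` whose partial derivative in the second parameter is annihilated
by `p`, the derivative in the second parameter of `p` applied to the partial derivative in the first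
parameter. -/
theorem exists_derivWithin_variation {F : ℝ × ℝ → E} {p : E → E →L[ℝ] E} {A : Set ℝ} {s₀ a b t : ℝ}
    (hA : IsOpen A) (hs₀ : s₀ ∈ A) (hab : a < b) (ht : t ∈ Icc a b)
    (hF : ContDiffWithinAt ℝ ∞ F (A ×ˢ Icc a b) (s₀, t)) (hp : ContDiffAt ℝ ∞ p (F (s₀, t)))
    (htan : ∀ᶠ s in 𝓝 s₀,
      p (F (s, t)) (fderivWithin ℝ F (A ×ˢ Icc a b) (s, t) ((0, 1) : ℝ × ℝ)) = 0) :
    ContDiffWithinAt ℝ ∞ (fun τ => p (F (s₀, τ))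
      (fderivWithin ℝ F (A ×ˢ Icc a b) (s₀, τ) ((1, 0) : ℝ × ℝ))) (Icc a b) t ∧
    ∃ m : E, fderiv ℝ p (F (s₀, t)) (fderivWithin ℝ F (A ×ˢ Icc a b) (s₀, t) ((1, 0) : ℝ × ℝ))
        (fderivWithin ℝ F (A ×ˢ Icc a b) (s₀, t) ((0, 1) : ℝ × ℝ)) + p (F (s₀, t)) m = 0 ∧
      derivWithin (fun τ => p (F (s₀, τ))
        (fderivWithin ℝ F (A ×ˢ Icc a b) (s₀, τ) ((1, 0) : ℝ × ℝ))) (Icc a b) t =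
      fderiv ℝ p (F (s₀, t)) (fderivWithin ℝ F (A ×ˢ Icc a b) (s₀, t) ((0, 1) : ℝ × ℝ))
        (fderivWithin ℝ F (A ×ˢ Icc a b) (s₀, t) ((1, 0) : ℝ × ℝ)) + p (F (s₀, t)) m := by
  set S := A ×ˢ Icc a b with hSdef
  have hzS : ((s₀, t) : ℝ × ℝ) ∈ S := ⟨hs₀, ht⟩
  have hS : UniqueDiffOn ℝ S := hA.uniqueDiffOn.prod (uniqueDiffOn_Icc hab)
  -- At the end points of `[a, b]` the point lies on the boundary of `S`; the symmetry of the second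
  -- derivative still holds because it is a limit of interior points.
  have hcl : ((s₀, t) : ℝ × ℝ) ∈ closure (interior S) := by
    rw [hSdef, interior_prod_eq, closure_prod_eq, hA.interior_eq, interior_Icc, closure_Ioo hab.ne]
    exact ⟨subset_closure hs₀, ht⟩
  have hG : ContDiffWithinAt ℝ ∞ (fderivWithin ℝ F S) S (s₀, t) :=
    hF.fderivWithin_right hS (by simp) hzS
  have hsymm := hF.isSymmSndFDerivWithinAt (by simpa using two_le_infty) hS hcl hzS
  have hFd := hF.differentiableWithinAt (by simp)
  have hGd := hG.differentiableWithinAt (by simp)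
  have hpd := hp.differentiableAt (by simp)
  have hmaps : MapsTo (fun τ => ((s₀, τ) : ℝ × ℝ)) (Icc a b) S := fun τ hτ => ⟨hs₀, hτ⟩
  have hmaps' : MapsTo (fun s => ((s, t) : ℝ × ℝ)) A S := fun s hs => ⟨hs, ht⟩
  have hline : ContDiffWithinAt ℝ ∞ (fun τ => ((s₀, τ) : ℝ × ℝ)) (Icc a b) t :=
    (contDiff_const.prodMk contDiff_id).contDiffWithinAt
  refine ⟨?_, fderivWithin ℝ (fderivWithin ℝ F S) S (s₀, t) ((0, 1) : ℝ × ℝ) ((1, 0) : ℝ × ℝ),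
    ?_, ?_⟩
  · exact ((hp.comp_contDiffWithinAt t (hF.comp t hline hmaps)).clm_apply
      ((hG.comp t hline hmaps).clm_apply contDiffWithinAt_const))
  · have h1 := hasDerivWithinAt_clm_apply_fderivWithin (c := fun s => ((s, t) : ℝ × ℝ)) (t := s₀)
      hFd hGd hpd ((hasDerivAt_id s₀).prodMk (hasDerivAt_const s₀ t)).hasDerivWithinAt hmaps'
      ((0, 1) : ℝ × ℝ)
    have h2 := (h1.hasDerivAt (hA.mem_nhds hs₀)).unique
      ((hasDerivAt_const s₀ (0 : E)).congr_of_eventuallyEq htan)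
    rw [← h2, hsymm]
  · exact (hasDerivWithinAt_clm_apply_fderivWithin (c := fun τ => ((s₀, τ) : ℝ × ℝ)) (t := t)
      hFd hGd hpd ((hasDerivAt_const t s₀).prodMk (hasDerivAt_id t)).hasDerivWithinAt hmaps
      ((1, 0) : ℝ × ℝ)).derivWithin (uniqueDiffOn_Icc hab t ht)

end VariationInVectorSpace

/-! ### Sections of `H`, their brackets in coordinates, and the curvature. -/

section Curvature

open Filter Topology

variable {E : Type*} [NormedAddCommGroup E] [NormedSpace ℝ E] [FiniteDimensional ℝ E]
  {M : Type*} [TopologicalSpace M] [ChartedSpace E M] [IsManifold 𝓘(ℝ, E) ∞ M]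
  {H K : ∀ p : M, Submodule ℝ (TangentSpace 𝓘(ℝ, E) p)}

/-- Every vector of a smooth subbundle is the value of a smooth section. -/
theorem IsSmoothSubbundle.exists_isSmoothSection [T2Space M] (hH : IsSmoothSubbundle H) {p : M}
    {u : TangentSpace 𝓘(ℝ, E) p} (hu : u ∈ H p) :
    ∃ X : ∀ q : M, TangentSpace 𝓘(ℝ, E) q, IsSmoothSection H X ∧ X p = u := by
  obtain ⟨U, hU, hpU, r, X, hX, hXs⟩ := hH p
  rw [← (hXs p hpU).2, Submodule.mem_span_range_iff_exists_fun] at hu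
  obtain ⟨a, ha⟩ := hu
  -- A bump function supported in the domain of the frame extends the local combination by zero.
  obtain ⟨f, -, hfU⟩ := (SmoothBumpFunction.nhds_basis_tsupport (I := 𝓘(ℝ, E)) p).mem_iff.1
    (hU.mem_nhds hpU)
  set Y : ∀ q : M, TangentSpace 𝓘(ℝ, E) q := fun q => ∑ i, a i • X i q with hY
  have hYs : ContMDiffOn 𝓘(ℝ, E) 𝓘(ℝ, E).tangent ∞
      (fun q => (⟨q, Y q⟩ : TangentBundle 𝓘(ℝ, E) M)) U :=
    ContMDiffOn.sum_section (t := fun i q => a i • X i q) fun i _ =>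
      (hX i).const_smul_section (a := a i)
  refine ⟨fun q => f q • Y q, ⟨?_, fun q => ?_⟩, ?_⟩
  · exact ContMDiffOn.smul_section_of_tsupport (ψ := f) (s := Y) f.contMDiff.contMDiffOn hU hfU hYs
  · by_cases hq : q ∈ tsupport f
    · refine (H q).smul_mem _ ?_
      rw [← (hXs q (hfU hq)).2]
      exact Submodule.sum_mem _ fun i _ =>
        Submodule.smul_mem _ _ (Submodule.subset_span (mem_range_self i))
    · simp [image_eq_zero_of_notMem_tsupport hq]
  · simp only [f.eq_one, one_smul, hY, ha]

/-- The curvature is represented by the bracket of sections with the given values. -/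
theorem exists_curvature_eq [T2Space M] (hH : IsSmoothSubbundle H) {p : M} (u v : H p) :
    ∃ X Y : ∀ q : M, TangentSpace 𝓘(ℝ, E) q, IsSmoothSection H X ∧ IsSmoothSection H Y ∧
      X p = u ∧ Y p = v ∧
      curvature H p u v = (H p).mkQ (VectorField.mlieBracket 𝓘(ℝ, E) X Y p) := by
  have h : ∃ XY : (∀ q : M, TangentSpace 𝓘(ℝ, E) q) × (∀ q : M, TangentSpace 𝓘(ℝ, E) q),
      IsSmoothSection H XY.1 ∧ IsSmoothSection H XY.2 ∧ XY.1 p = u ∧ XY.2 p = v := by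
    obtain ⟨X, hX, hXu⟩ := hH.exists_isSmoothSection u.2
    obtain ⟨Y, hY, hYv⟩ := hH.exists_isSmoothSection v.2
    exact ⟨(X, Y), hX, hY, hXu, hYv⟩
  refine ⟨h.choose.1, h.choose.2, h.choose_spec.1, h.choose_spec.2.1, h.choose_spec.2.2.1,
    h.choose_spec.2.2.2, ?_⟩
  rw [curvature, dif_pos h]

omit [IsManifold 𝓘(ℝ, E) ∞ M] [FiniteDimensional ℝ E] in
theorem projAlong_coe_eq_sub (h : ∀ p, IsCompl (H p) (K p)) {p : M} (w : TangentSpace 𝓘(ℝ, E) p) :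
    (projAlong h p w : TangentSpace 𝓘(ℝ, E) p) = w - tangentProj h p w := by
  have h1 : (projAlong h p w : TangentSpace 𝓘(ℝ, E) p) + tangentProj h p w = w :=
    Submodule.projection_add_projection_eq_self (h p) w
  exact eq_sub_of_add_eq h1

omit [FiniteDimensional ℝ E] in
/-- The Lie bracket of vector fields in the preferred chart. -/
theorem mlieBracket_eq_lieBracket_fieldCoord (X Y : ∀ q : M, TangentSpace 𝓘(ℝ, E) q) (x : M) :
    VectorField.mlieBracket 𝓘(ℝ, E) X Y x =
      VectorField.lieBracket ℝ (fieldCoord x X) (fieldCoord x Y) (extChartAt 𝓘(ℝ, E) x x) := by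
  -- The bracket on the manifold is defined by pulling the fields back under the inverse chart; near
  -- the point these pullbacks are the coordinate expressions.
  have hpull : ∀ V : ∀ q : M, TangentSpace 𝓘(ℝ, E) q,
      VectorField.mpullbackWithin 𝓘(ℝ, E) 𝓘(ℝ, E) (extChartAt 𝓘(ℝ, E) x).symm V (range 𝓘(ℝ, E))
        =ᶠ[𝓝 (extChartAt 𝓘(ℝ, E) x x)] fieldCoord x V := by
    intro V
    filter_upwards [extChartAt_target_mem_nhds (I := 𝓘(ℝ, E)) x] with y hy
    rw [VectorField.mpullbackWithin_apply]
    have h1 := isInvertible_mfderivWithin_extChartAt_symm hy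
    have h2 : mfderivWithin 𝓘(ℝ, E) 𝓘(ℝ, E) (extChartAt 𝓘(ℝ, E) x).symm (range 𝓘(ℝ, E)) y
        (fieldCoord (E := E) x V y) = V ((extChartAt 𝓘(ℝ, E) x).symm y) := by
      rw [ModelWithCorners.range_eq_univ, mfderivWithin_univ]
      refine (tcoordSymm_apply_eq_mfderiv hy _).symm.trans ?_
      exact tcoordSymm_tcoord (mem_source_symm hy) _
    exact h1.inverse_apply_eq.2 h2.symm
  have hset : (extChartAt 𝓘(ℝ, E) x).symm ⁻¹' univ ∩ range 𝓘(ℝ, E) = univ := by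
    rw [preimage_univ, ModelWithCorners.range_eq_univ, univ_inter]
  -- In the preferred chart the differential of the chart at its centre is the identity, so
  -- returning from coordinates changes nothing.
  have hid : (mfderiv 𝓘(ℝ, E) 𝓘(ℝ, E) (extChartAt 𝓘(ℝ, E) x) x : E →L[ℝ] E) =
      ContinuousLinearMap.id ℝ E := mfderiv_extChartAt_self
  set V : E → E :=
    VectorField.mpullbackWithin 𝓘(ℝ, E) 𝓘(ℝ, E) (extChartAt 𝓘(ℝ, E) x).symm X (range 𝓘(ℝ, E))
    with hV
  set W : E → E :=
    VectorField.mpullbackWithin 𝓘(ℝ, E) 𝓘(ℝ, E) (extChartAt 𝓘(ℝ, E) x).symm Y (range 𝓘(ℝ, E))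
    with hW
  have h1 : VectorField.mlieBracket 𝓘(ℝ, E) X Y x =
      ContinuousLinearMap.inverse
        (mfderiv 𝓘(ℝ, E) 𝓘(ℝ, E) (extChartAt 𝓘(ℝ, E) x) x : E →L[ℝ] E)
        (VectorField.lieBracketWithin ℝ (E := E) V W
          ((extChartAt 𝓘(ℝ, E) x).symm ⁻¹' univ ∩ range 𝓘(ℝ, E)) (extChartAt 𝓘(ℝ, E) x x)) := rfl
  have h2 : ∀ L : E →L[ℝ] E, L = ContinuousLinearMap.id ℝ E → ∀ w, L.inverse w = w := by
    rintro _ rfl w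
    rw [ContinuousLinearMap.inverse_id, ContinuousLinearMap.id_apply]
  refine h1.trans ((h2 _ hid _).trans ?_)
  rw [hset, VectorField.lieBracketWithin_univ,
    (hpull X : V =ᶠ[_] _).lieBracket_vectorField_eq (hpull Y : W =ᶠ[_] _)]

omit [FiniteDimensional ℝ E] in
theorem fieldCoord_extChartAt_self (X : ∀ q : M, TangentSpace 𝓘(ℝ, E) q) (x : M) :
    fieldCoord x X (extChartAt 𝓘(ℝ, E) x x) = tcoord x x (X x) := by
  have h : ∀ q : M, q = x → tcoord x q (X q) = tcoord x x (X x) := by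
    rintro _ rfl
    rfl
  exact h _ (extChartAt_to_inv x)

/-- The derivative of the relation `P X = 0`, for a section `X` of `H`. -/
theorem fderiv_coordProj_fieldCoord (h : ∀ p, IsCompl (H p) (K p)) (hH : IsSmoothSubbundle H)
    (hK : IsSmoothSubbundle K) {X : ∀ q : M, TangentSpace 𝓘(ℝ, E) q} (hX : IsSmoothSection H X)
    {x : M} {y : E} (hy : y ∈ (extChartAt 𝓘(ℝ, E) x).target) (v : E) :
    fderiv ℝ (coordProj h x) y v (fieldCoord x X y) +
      coordProj h x y (fderiv ℝ (fieldCoord x X) y v) = 0 := by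
  have hnhds := (isOpen_extChartAt_target (I := 𝓘(ℝ, E)) x).mem_nhds hy
  have h1 : (fun y => coordProj h x y (fieldCoord x X y)) =ᶠ[𝓝 y] fun _ => 0 := by
    filter_upwards [hnhds] with y hy
    rw [fieldCoord, coordProj_tcoord_symm h hy, tangentProj_of_mem_compl h (hX.2 _), map_zero]
  have h2 := (((contDiffOn_coordProj h hH hK x).contDiffAt hnhds).differentiableAt
    (by simp)).hasFDerivAt.clm_apply
      ((contDiffAt_fieldCoord hy hX.1.contMDiffAt).differentiableAt (by simp)).hasFDerivAt
  have h3 := DFunLike.congr_fun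
    (h2.unique ((hasFDerivAt_const (0 : E) y).congr_of_eventuallyEq h1)) v
  simpa [add_comm] using h3

end Curvature

/-! ### The first variation formula. -/

section FirstVariation

open Filter Topology

variable {E : Type*} [NormedAddCommGroup E] [NormedSpace ℝ E]
  {M : Type*} [TopologicalSpace M] [ChartedSpace E M] [IsManifold 𝓘(ℝ, E) ∞ M]

/-- The velocity of the image of a curve under a map into a manifold, in a chart. -/
theorem tcoord_mfderivWithin_comp {V : Type*} [NormedAddCommGroup V] [NormedSpace ℝ V]
    {f : V → M} {S : Set V} {T : Set ℝ} {c : ℝ → V} {c' : V} {t : ℝ} {x₀ : M}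
    (hf : ContMDiffWithinAt 𝓘(ℝ, V) 𝓘(ℝ, E) ∞ f S (c t)) (hc : HasDerivWithinAt c c' T t)
    (hcT : MapsTo c T S) (hT : UniqueDiffWithinAt ℝ T t) (hx : f (c t) ∈ (chartAt E x₀).source) :
    tcoord x₀ (f (c t)) (mfderivWithin 𝓘(ℝ, ℝ) 𝓘(ℝ, E) (fun τ => f (c τ)) T t (1 : ℝ)) =
      fderivWithin ℝ (fun w => extChartAt 𝓘(ℝ, E) x₀ (f w)) S (c t) c' := by
  have h1 : MDifferentiableWithinAt 𝓘(ℝ, ℝ) 𝓘(ℝ, E) (fun τ => f (c τ)) T t :=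
    (hf.mdifferentiableWithinAt (by simp)).comp t
      hc.differentiableWithinAt.mdifferentiableWithinAt hcT
  have h2 := (((contMDiffWithinAt_iff_coord hx).1 hf).2.differentiableWithinAt
    (by simp)).hasFDerivWithinAt.comp_hasDerivWithinAt t hc hcT
  rw [tcoord_mfderivWithin (f := fun τ => f (c τ)) hT hx h1, fderivWithin_derivWithin]
  exact h2.derivWithin hT

variable [FiniteDimensional ℝ E] [T2Space M]
  {H K : ∀ p : M, Submodule ℝ (TangentSpace 𝓘(ℝ, E) p)} {h : ∀ p, IsCompl (H p) (K p)}
  {β : ℝ → ℝ → M} {A : Set ℝ} {s₀ a b : ℝ}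

omit [FiniteDimensional ℝ E] [IsManifold 𝓘(ℝ, E) ∞ M] [T2Space M] in
theorem isHorizontalPath_of_variation (hs₀ : s₀ ∈ A) (hab : a < b)
    (hβ : ContMDiffOn 𝓘(ℝ, ℝ × ℝ) 𝓘(ℝ, E) ∞ (fun z : ℝ × ℝ => β z.1 z.2) (A ×ˢ Icc a b))
    (htan : ∀ t ∈ Icc a b, pathVelocity (β s₀) a b t ∈ H (β s₀ t)) :
    IsHorizontalPath H (β s₀) a b where
  lt := hab
  smooth := hβ.comp (f := fun τ => ((s₀, τ) : ℝ × ℝ))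
    (contDiff_const.prodMk contDiff_id).contMDiff.contMDiffOn fun _ hτ => ⟨hs₀, hτ⟩
  tangent := htan

/-- The first variation formula for paths tangent to `H`. -/
theorem covDeriv_variationComponent (hH : IsSmoothSubbundle H) (hK : IsSmoothSubbundle K)
    (hA : IsOpen A) (hs₀ : s₀ ∈ A) (hab : a < b)
    (hβ : ContMDiffOn 𝓘(ℝ, ℝ × ℝ) 𝓘(ℝ, E) ∞ (fun z : ℝ × ℝ => β z.1 z.2) (A ×ˢ Icc a b))
    (htan : ∀ s ∈ A, ∀ t ∈ Icc a b, pathVelocity (β s) a b t ∈ H (β s t))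
    {t : ℝ} (ht : t ∈ Icc a b) :
    IsSmoothAlongAt (β s₀) a b (variationComponent h β s₀) t ∧
      covDeriv h (β s₀) a b (variationComponent h β s₀) t =
        curvatureTerm h β s₀ t ⟨pathVelocity (β s₀) a b t, htan s₀ hs₀ t ht⟩ := by
  have hγ := isHorizontalPath_of_variation hs₀ hab hβ (htan s₀ hs₀)
  set x := β s₀ t with hx
  set p := coordProj h x with hpdef
  set S := A ×ˢ Icc a b with hS
  set F : ℝ × ℝ → E := fun w => extChartAt 𝓘(ℝ, E) x (β w.1 w.2) with hF
  have hxs : x ∈ (chartAt E x).source := mem_chart_source E x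
  have hxt : extChartAt 𝓘(ℝ, E) x x ∈ (extChartAt 𝓘(ℝ, E) x).target := mem_extChartAt_target x
  have hzS : ((s₀, t) : ℝ × ℝ) ∈ S := ⟨hs₀, ht⟩
  have hFz : ContDiffWithinAt ℝ ∞ F S (s₀, t) :=
    ((contMDiffWithinAt_iff_coord (f := fun z : ℝ × ℝ => β z.1 z.2) hxs).1 (hβ _ hzS)).2
  have hpz : ContDiffAt ℝ ∞ p (F (s₀, t)) :=
    (contDiffOn_coordProj h hH hK x).contDiffAt ((isOpen_extChartAt_target x).mem_nhds hxt)
  have hds : ∀ τ ∈ Icc a b, β s₀ τ ∈ (chartAt E x).source →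
      tcoord x (β s₀ τ) (mfderiv 𝓘(ℝ, ℝ) 𝓘(ℝ, E) (fun s => β s τ) s₀ (1 : ℝ)) =
        fderivWithin ℝ F S (s₀, τ) ((1, 0) : ℝ × ℝ) := by
    intro τ hτ hsrc
    have h1 := tcoord_mfderivWithin_comp (f := fun z : ℝ × ℝ => β z.1 z.2)
      (c := fun s => ((s, τ) : ℝ × ℝ)) (T := A) (t := s₀) (hβ _ ⟨hs₀, hτ⟩)
      ((hasDerivAt_id s₀).prodMk (hasDerivAt_const s₀ τ)).hasDerivWithinAt
      (fun s hs => ⟨hs, hτ⟩) (hA.uniqueDiffWithinAt hs₀) hsrc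
    rw [mfderivWithin_of_isOpen hA hs₀] at h1
    exact h1
  have hdt : ∀ s ∈ A, β s t ∈ (chartAt E x).source →
      tcoord x (β s t) (pathVelocity (β s) a b t) =
        fderivWithin ℝ F S (s, t) ((0, 1) : ℝ × ℝ) := fun s hs hsrc =>
    tcoord_mfderivWithin_comp (f := fun z : ℝ × ℝ => β z.1 z.2)
      (c := fun τ => ((s, τ) : ℝ × ℝ)) (T := Icc a b) (t := t) (hβ _ ⟨hs, ht⟩)
      ((hasDerivAt_const t s).prodMk (hasDerivAt_id t)).hasDerivWithinAt
      (fun τ hτ => ⟨hs, hτ⟩) (uniqueDiffOn_Icc hab t ht) hsrc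
  have hsrcA : ∀ᶠ s in 𝓝 s₀, β s t ∈ (chartAt E x).source := by
    have h1 : ContinuousWithinAt (fun s => β s t) A s₀ :=
      (hβ.continuousOn.comp (f := fun s => ((s, t) : ℝ × ℝ)) (by fun_prop)
        fun s hs => ⟨hs, ht⟩) s₀ hs₀
    exact (h1.continuousAt (hA.mem_nhds hs₀)) ((chartAt E x).open_source.mem_nhds hxs)
  -- Tangency to `H` is used here for all nearby `s`, not only for `s₀`: it is what may be
  -- differentiated in `s`.
  obtain ⟨hsm, m, hm, hder⟩ := exists_derivWithin_variation hA hs₀ hab ht hFz hpz (by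
    filter_upwards [hsrcA, hA.mem_nhds hs₀] with s hsrc hs
    rw [← hdt s hs hsrc]
    exact coordProj_tcoord_of_mem_compl h hsrc (htan s hs t ht))
  have hsec : sectionCoord x (β s₀) (variationComponent h β s₀) =ᶠ[𝓝[Icc a b] t]
      fun τ => p (F (s₀, τ)) (fderivWithin ℝ F S (s₀, τ) ((1, 0) : ℝ × ℝ)) := by
    filter_upwards [hγ.eventually_mem_source ht hxs, self_mem_nhdsWithin] with τ hsrc hτ
    rw [← hds τ hτ hsrc]
    exact (coordProj_tcoord h hsrc _).symm
  have hsect := hsec.self_of_nhdsWithin ht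
  have hZ : IsSmoothAlongAt (β s₀) a b (variationComponent h β s₀) t :=
    (isSmoothAlongAt_iff hγ ht hxs).2 ((hsec.congr_contDiffWithinAt hsect).2 hsm)
  refine ⟨hZ, ?_⟩
  have hpath : derivWithin (pathCoord E x (β s₀)) (Icc a b) t =
      fderivWithin ℝ F S (s₀, t) ((0, 1) : ℝ × ℝ) :=
    ((hFz.differentiableWithinAt (by simp)).hasFDerivWithinAt.comp_hasDerivWithinAt t
      (f := fun τ => ((s₀, τ) : ℝ × ℝ))
      ((hasDerivAt_const t s₀).prodMk (hasDerivAt_id t)).hasDerivWithinAt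
      (fun τ hτ => ⟨hs₀, hτ⟩)).derivWithin (uniqueDiffOn_Icc hab t ht)
  have hleft := tcoord_covDeriv_eq h hH hK hγ ht hxs hZ
  rw [hpath, hsec.derivWithin_eq hsect, hsect, hder] at hleft
  -- The extensions `X` and `Y` are the ones representing the curvature. They are sections over `M`,
  -- unrelated to `β` away from the point `x`, and only their values at `x` are matched with the
  -- variation.
  obtain ⟨X, Y, hX, hY, hXx, hYx, hcurv⟩ := exists_curvature_eq hH
    (projAlong h x (mfderiv 𝓘(ℝ, ℝ) 𝓘(ℝ, E) (fun s => β s t) s₀ (1 : ℝ)))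
    ⟨pathVelocity (β s₀) a b t, htan s₀ hs₀ t ht⟩
  have hXc : fieldCoord x X (F (s₀, t)) = fderivWithin ℝ F S (s₀, t) ((1, 0) : ℝ × ℝ) -
      p (F (s₀, t)) (fderivWithin ℝ F S (s₀, t) ((1, 0) : ℝ × ℝ)) := by
    rw [← hds t ht hxs]
    refine (fieldCoord_extChartAt_self X x).trans ?_
    rw [hXx, projAlong_coe_eq_sub, map_sub]
    exact congrArg _ (coordProj_tcoord h hxs _).symm
  have hYc : fieldCoord x Y (F (s₀, t)) = fderivWithin ℝ F S (s₀, t) ((0, 1) : ℝ × ℝ) := by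
    rw [← hdt s₀ hs₀ hxs]
    refine (fieldCoord_extChartAt_self Y x).trans ?_
    rw [hYx]
  -- The relation `p X = 0` is differentiated in the direction of `Y`, and `p Y = 0` in the
  -- direction of `X`; these are the two halves of the bracket.
  have ha := fderiv_coordProj_fieldCoord h hH hK hX hxt
    (fderivWithin ℝ F S (s₀, t) ((0, 1) : ℝ × ℝ))
  have hb := fderiv_coordProj_fieldCoord h hH hK hY hxt (fieldCoord x X (F (s₀, t)))
  change fderiv ℝ p (F (s₀, t)) _ (fieldCoord x X (F (s₀, t))) + _ = 0 at ha
  change fderiv ℝ p (F (s₀, t)) _ (fieldCoord x Y (F (s₀, t))) + _ = 0 at hb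
  rw [hXc] at ha hb
  rw [hYc] at hb
  have hmain := covDeriv_eq_bracket_of_leibniz (q := p (F (s₀, t)))
    (D := fderiv ℝ p (F (s₀, t))) (fun w => coordProj_coordProj h hxt w)
    (fun v w => fderiv_idempotent_apply (hpz.differentiableAt (by simp))
      (Filter.eventually_of_mem ((isOpen_extChartAt_target x).mem_nhds hxt)
        fun y hy w => coordProj_coordProj h hy w) v w) hm ha hb
  have hright : tcoord x x (curvatureTerm h β s₀ t
      ⟨pathVelocity (β s₀) a b t, htan s₀ hs₀ t ht⟩ : TangentSpace 𝓘(ℝ, E) x) =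
      p (F (s₀, t)) (fderiv ℝ (fieldCoord x Y) (F (s₀, t)) (fieldCoord x X (F (s₀, t))) -
        fderiv ℝ (fieldCoord x X) (F (s₀, t)) (fieldCoord x Y (F (s₀, t)))) := by
    -- The isomorphism `TM / H ≃ K` after the quotient map is the projection on `K` along `H`.
    have h1 : (curvatureTerm h β s₀ t ⟨pathVelocity (β s₀) a b t, htan s₀ hs₀ t ht⟩ :
        TangentSpace 𝓘(ℝ, E) x) = tangentProj h x (VectorField.mlieBracket 𝓘(ℝ, E) X Y x) :=
      congrArg (fun w => ((quotIso h x w : K x) : TangentSpace 𝓘(ℝ, E) x)) hcurv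
    rw [h1, ← coordProj_tcoord h hxs, tcoord_self, mlieBracket_eq_lieBracket_fieldCoord]
    rfl
  rw [hXc, hYc] at hright
  exact (tcoord_self (E := E) _).symm.trans
    ((hleft.trans (hmain.trans hright.symm)).trans (tcoord_self (E := E) _))

end FirstVariation

theorem theorem9 {E : Type*} [NormedAddCommGroup E] [NormedSpace ℝ E] [FiniteDimensional ℝ E]
    {M : Type*} [TopologicalSpace M] [T2Space M] [ChartedSpace E M] [IsManifold 𝓘(ℝ, E) ∞ M]
    (H K : ∀ p : M, Submodule ℝ (TangentSpace 𝓘(ℝ, E) p))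
    (hH : IsSmoothSubbundle H) (hK : IsSmoothSubbundle K) (hHK : ∀ p, IsCompl (H p) (K p))
    (a b s₀ ε : ℝ) (hab : a < b) (hε : 0 < ε) (β : ℝ → ℝ → M)
    (hβ : ContMDiffOn 𝓘(ℝ, ℝ × ℝ) 𝓘(ℝ, E) ∞ (fun z : ℝ × ℝ => β z.1 z.2)
      (Ioo (s₀ - ε) (s₀ + ε) ×ˢ Icc a b))
    (htan : ∀ s ∈ Ioo (s₀ - ε) (s₀ + ε), ∀ t ∈ Icc a b, pathVelocity (β s) a b t ∈ H (β s t)) :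
    IsSmoothAlong (β s₀) a b (variationComponent hHK β s₀) ∧
    (∀ (t : ℝ) (ht : t ∈ Icc a b),
      covDeriv hHK (β s₀) a b (variationComponent hHK β s₀) t =
        curvatureTerm hHK β s₀ t
          ⟨pathVelocity (β s₀) a b t, htan s₀ ⟨sub_lt_self s₀ hε, lt_add_of_pos_right s₀ hε⟩ t ht⟩) ∧
    (∀ t₀ ∈ Icc a b, ∀ (t : ℝ) (ht : t ∈ Icc a b),
      HasDerivWithinAt
        (fun τ : ℝ => ((parallelTransport hHK (β s₀) a b τ t₀ (variationComponent hHK β s₀ τ) :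
          K (β s₀ t₀)) : TangentSpace 𝓘(ℝ, E) (β s₀ t₀)))
        (parallelTransport hHK (β s₀) a b t t₀
          (curvatureTerm hHK β s₀ t
            ⟨pathVelocity (β s₀) a b t, htan s₀ ⟨sub_lt_self s₀ hε, lt_add_of_pos_right s₀ hε⟩ t ht⟩) :
          K (β s₀ t₀))
        (Icc a b) t) := by
  have hs₀ : s₀ ∈ Ioo (s₀ - ε) (s₀ + ε) := ⟨sub_lt_self s₀ hε, lt_add_of_pos_right s₀ hε⟩
  have hγ := isHorizontalPath_of_variation hs₀ hab hβ (htan s₀ hs₀)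
  have hvar := fun (t : ℝ) (ht : t ∈ Icc a b) =>
    covDeriv_variationComponent (h := hHK) hH hK isOpen_Ioo hs₀ hab hβ htan ht
  exact ⟨fun t ht => (hvar t ht).1, fun t ht => (hvar t ht).2, fun t₀ ht₀ t ht =>
    hasDerivWithinAt_parallelTransport hH hK hγ ht ht₀ (hvar t ht).1 (hvar t ht).2⟩
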